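/- Let $d\ge 1$ and let $\mathcal H=\mathcal H_A\otimes\mathcal H_B\otimes\mathcal H_C\otimes\mathcal H_D$ with each factor equal to $\mathbb C^d$. For a unit vector $\psi\in\mathcal H$ and a set $S$ of parties, let $\rho_S(\psi)=\operatorname{Tr}_{\bar S}|\psi\rangle\langle\psi|$ be the marginal on $S$, where the partial trace is over all parties not in $S$. Then for almost every unit vector $\psi\in\mathcal H$, with respect to the Haar measure (the unitarily invariant probability measure on the unit sphere of $\mathcal H$), the following holds. The state $\psi$ is uniquely determined among pure states by its three two-body marginals on $AB$, $CD$ and $BD$: every unit vector $\varphi\in\mathcal H$ with $\rho_{AB}(\varphi)=\rho_{AB}(\psi)$, $\rho_{CD}(\varphi)=\rho_{CD}(\psi)$ and $\rho_{BD}(\varphi)=\rho_{BD}(\psi)$ is of the form $\varphi=z\psi$ with $z\in\mathbb C$, $|z|=1$. In particular, $\psi$ is $2$-UDP: every unit vector $\varphi\in\mathcal H$ that has the same marginals as $\psi$ on all two-element sets of parties is of the form $\varphi=z\psi$ with $|z|=1$. -/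

import Mathlib

open MeasureTheory

noncomputable section

/-- The Hilbert space `(ℂ^d)^{⊗ n}` of `n` qudits of local dimension `d`, with the product basis
labelled by the functions `Fin n → Fin d`. -/
abbrev Qudits (n d : ℕ) : Type := EuclideanSpace ℂ (Fin n → Fin d)

/-- Unit vectors of `(ℂ^d)^{⊗ n}`, representing the pure states. -/
abbrev PureVec (n d : ℕ) : Type := Metric.sphere (0 : Qudits n d) 1

/-- The Haar measure on pure states: Lebesgue measure on the unit sphere, normalized to total
mass `1`, i.e. the unitarily invariant Borel probability measure on the sphere. -/
def haarPure (n d : ℕ) : Measure (PureVec n d) :=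
  ((volume : Measure (Qudits n d)).toSphere Set.univ)⁻¹ • (volume : Measure (Qudits n d)).toSphere

/-- The density matrix `|ψ⟩⟨ψ|`. -/
def density {n d : ℕ} (ψ : PureVec n d) : Matrix (Fin n → Fin d) (Fin n → Fin d) ℂ :=
  fun a b => (ψ : Qudits n d) a * star ((ψ : Qudits n d) b)

/-- Basis label of the whole system, glued from a label `a` of the parties in `S` and a label `c`
of the remaining parties. -/
def glue {n d : ℕ} (S : Finset (Fin n)) (a : {i // i ∈ S} → Fin d) (c : {i // i ∉ S} → Fin d) :
    Fin n → Fin d :=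
  fun i => if h : i ∈ S then a ⟨i, h⟩ else c ⟨i, h⟩

/-- The marginal `ρ_S` of `ρ` on the parties in `S`: the partial trace over all other parties. -/
def marginal {n d : ℕ} (S : Finset (Fin n)) (ρ : Matrix (Fin n → Fin d) (Fin n → Fin d) ℂ) :
    Matrix ({i // i ∈ S} → Fin d) ({i // i ∈ S} → Fin d) ℂ :=
  fun a b => ∑ c : {i // i ∉ S} → Fin d, ρ (glue S a c) (glue S b c)

/-- `ψ` is uniquely determined among pure states by its marginals on the sets of parties in `𝒮`:
every pure state with the same marginals is the same physical state, i.e. is represented by a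
vector that differs from `ψ` only by a phase. -/
def DeterminedAmongPure {n d : ℕ} (𝒮 : Set (Finset (Fin n))) (ψ : PureVec n d) : Prop :=
  ∀ φ : PureVec n d, (∀ S ∈ 𝒮, marginal S (density φ) = marginal S (density ψ)) →
    ∃ z : ℂ, ‖z‖ = 1 ∧ (φ : Qudits n d) = z • (ψ : Qudits n d)

/-- `k`-UDP: uniquely determined among pure states by all the `k`-body marginals. -/
def IsUDP {n d : ℕ} (k : ℕ) (ψ : PureVec n d) : Prop :=
  DeterminedAmongPure {S : Finset (Fin n) | S.card = k} ψ

end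

/-! ### Hausdorff dimension of zero sets; semicontinuity of rank. -/

open Module Set Filter Topology

/-! In suitable coordinates the three marginals determine a quadratic map `ψ ↦ D ψ ψ`, with `D` real
bilinear, symmetric and invariant under multiplying both arguments by `i`. Let N be the real
dimension of the space. Two first-order conditions at `ψ` are used: the kernel of `D ψ` lies in the
phase direction `ℝ iψ`, and the range of `D φ` lies in that of `D ψ` only if `φ ∈ ℂψ`. Consider
pairs with `D φ φ = D ψ ψ` and `φ ∉ ℂψ`. The linearized equation `D φ η = D ψ ξ` has a solution
space of dimension at most N: `η` cannot be arbitrary, and `η` determines `ξ` up to at most a line.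
Fixing the phase of `φ` removes one more dimension. So these pairs form a set of Hausdorff dimension
below N, and its projection to `ψ` is null (`ae_determined_of_polar`).

For `ψ ≠ 0` the two conditions together say that the linear system `D φ = D ψ ∘ Λ` in `(φ, Λ)` has
only its trivial solutions, a space of dimension N + 2. This is a rank condition, given by
polynomials in `ψ`, so it holds almost everywhere once it holds at one point (`ae_determined`).

The point is a superposition `∑ w i β i ⊗ conj (β i)` over the Bell vectors `β i` of AB and their
conjugates on CD. To first order, distinct `|w i|` let the AB and CD marginals fix everything but
the relative phases. The BD marginal amounts to the correlations of Weyl operators on B and D; these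
permute Bell vectors up to phases and so couple different `i`. One dominant weight makes the
remaining linear equations solvable only trivially (`diagonalTensor_infinitesimal`,
`diagonalTensor_range`). -/

lemma measure_eq_zero_of_dimH_lt_finrank {E : Type*} [NormedAddCommGroup E] [NormedSpace ℝ E]
    [FiniteDimensional ℝ E] [MeasurableSpace E] [BorelSpace E] (μ : Measure E)
    [μ.IsAddHaarMeasure] {s : Set E} (h : dimH s < finrank ℝ E) : μ s = 0 := by
  have h1 : (μH[finrank ℝ E] : Measure E) s = 0 := by
    have := hausdorffMeasure_of_dimH_lt (d := (finrank ℝ E : NNReal)) (s := s) (by simpa using h)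
    simpa using this
  exact Measure.absolutelyContinuous_isAddHaarMeasure μ _ h1

/-- Near a point of strict differentiability, the zero set of a map has dimension at most the
dimension of the kernel of the derivative. -/
lemma exists_nhds_dimH_zeroSet_le {E Y : Type*} [NormedAddCommGroup E] [NormedSpace ℝ E]
    [FiniteDimensional ℝ E] [NormedAddCommGroup Y] [NormedSpace ℝ Y] {F : E → Y} {F' : E →L[ℝ] Y}
    {p : E} (hF : HasStrictFDerivAt F F' p) :
    ∃ U ∈ 𝓝 p, dimH (U ∩ {q | F q = 0}) ≤ finrank ℝ F'.ker := by
  obtain ⟨P, hP⟩ := (F'.ker).subtype.exists_leftInverse_of_injective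
    (LinearMap.ker_eq_bot.2 Subtype.val_injective)
  let Pc : E →L[ℝ] F'.ker := LinearMap.toContinuousLinearMap P
  have hPc : ∀ x : F'.ker, Pc x = x := fun x => LinearMap.congr_fun hP x
  -- Adjoining a projection onto the kernel makes the derivative injective, hence bounded below by
  -- `1 / K`. An approximation error of `1 / (2K)` absorbs only half of that bound, so on the zero
  -- set, where `F` drops out, the projection alone is antilipschitz.
  let G : E → Y × F'.ker := fun x => (F x, Pc x)
  let G' : E →L[ℝ] Y × F'.ker := F'.prod Pc
  have hG : HasStrictFDerivAt G G' p := hF.prodMk Pc.hasStrictFDerivAt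
  obtain ⟨K, hK0, hK⟩ := LinearMap.exists_antilipschitzWith (G' : E →ₗ[ℝ] Y × F'.ker) (by
    rw [LinearMap.ker_eq_bot']
    intro x hx
    have h1 : F' x = 0 := congrArg Prod.fst hx
    have h2 : Pc x = 0 := congrArg Prod.snd hx
    have := hPc ⟨x, h1⟩
    simp only [h2] at this
    exact (congrArg Subtype.val this).symm)
  obtain ⟨U, hU, hUa⟩ := hG.approximates_deriv_on_nhds (c := (2 * K)⁻¹)
    (Or.inr (by positivity))
  refine ⟨U, hU, ?_⟩
  set s := U ∩ {q | F q = 0}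
  have hanti : AntilipschitzWith (2 * K) (fun x : s => Pc x) := by
    refine AntilipschitzWith.of_le_mul_dist fun x y => ?_
    have h1 := hUa x.1 x.2.1 y.1 y.2.1
    have h2 := hK.le_mul_dist x.1 y.1
    have h3 : F x.1 = 0 := x.2.2
    have h4 : F y.1 = 0 := y.2.2
    have h5 : G x.1 - G y.1 = (0, Pc x.1 - Pc y.1) := by simp [G, h3, h4]
    have h6 : ‖G x.1 - G y.1‖ = ‖Pc x.1 - Pc y.1‖ := by
      rw [h5, Prod.norm_def]; simp
    rw [Subtype.dist_eq, dist_eq_norm, dist_eq_norm] at *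
    have h7 : ‖G' x.1 - G' y.1‖ ≤ ‖Pc x.1 - Pc y.1‖ + ((2 * K)⁻¹ : NNReal) * ‖x.1 - y.1‖ := by
      rw [← h6, ← map_sub]
      calc ‖G' (x.1 - y.1)‖ = ‖(G x.1 - G y.1) - (G x.1 - G y.1 - G' (x.1 - y.1))‖ := by
            congr 1; abel
        _ ≤ _ := (norm_sub_le _ _).trans (by gcongr)
    have h8 : ‖x.1 - y.1‖ ≤ K * ‖G' x.1 - G' y.1‖ := h2
    have hKr : (0 : ℝ) < K := hK0
    push_cast at h7 ⊢
    have h9 : (K : ℝ) * ((2 * (K : ℝ))⁻¹ * ‖x.1 - y.1‖) = ‖x.1 - y.1‖ / 2 := by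
      field_simp
    nlinarith [mul_le_mul_of_nonneg_left h7 hKr.le]
  calc dimH s = dimH (univ : Set s) := by
        rw [← isometry_subtype_coe.dimH_image (univ : Set s)]; simp
    _ ≤ dimH ((fun x : s => Pc x) '' univ) := hanti.le_dimH_image _
    _ ≤ dimH (univ : Set F'.ker) := dimH_mono (subset_univ _)
    _ = _ := Real.dimH_univ_eq_finrank _

/-- Hausdorff dimension is local: a set of dimension above `m` has a point all of whose
neighbourhoods in the set have dimension above `m`. -/
lemma dimH_le_of_finrank_ker_le {E Y : Type*} [NormedAddCommGroup E] [NormedSpace ℝ E]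
    [FiniteDimensional ℝ E] [NormedAddCommGroup Y] [NormedSpace ℝ Y] {F : E → Y}
    {F' : E → E →L[ℝ] Y} {s : Set E} {m : ℕ} (hF : ∀ p ∈ s, HasStrictFDerivAt F (F' p) p)
    (hs : ∀ p ∈ s, F p = 0) (hm : ∀ p ∈ s, finrank ℝ (F' p).ker ≤ m) : dimH s ≤ m := by
  by_contra! h
  obtain ⟨p, hp, hpt⟩ := exists_mem_nhdsWithin_lt_dimH_of_lt_dimH h
  obtain ⟨U, hU, hUd⟩ := exists_nhds_dimH_zeroSet_le (hF p hp)
  have h1 : U ∩ {q | F q = 0} ∈ 𝓝[s] p :=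
    inter_mem (mem_nhdsWithin_of_mem_nhds hU) (mem_of_superset self_mem_nhdsWithin hs)
  exact absurd ((hpt _ h1).trans_le hUd) (by simpa using hm p hp)

/-- The rank of an affine family of linear maps is bounded below on the complement of the zero set
of a polynomial. -/
lemma exists_polynomial_finrank_ker_le {V X Y : Type*} [NormedAddCommGroup V] [NormedSpace ℝ V]
    [FiniteDimensional ℝ V] [AddCommGroup X] [Module ℝ X] [FiniteDimensional ℝ X]
    [AddCommGroup Y] [Module ℝ Y] (A : X →ₗ[ℝ] Y) (B : V →ₗ[ℝ] X →ₗ[ℝ] Y) (v₀ : V) :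
    ∃ f : V → ℝ, Continuous f ∧ f v₀ ≠ 0 ∧
      (∀ v, f v ≠ 0 → finrank ℝ (A + B v).ker ≤ finrank ℝ (A + B v₀).ker) ∧
      ∀ v w, f v ≠ 0 → {t : ℝ | f (v + t • w) = 0}.Finite := by
  -- The polynomial is the determinant of `A + B v` compressed to a complement `C` of the kernel at
  -- `v₀`, normalized to be 1 at `v₀`. Where it does not vanish, the kernel at `v` meets `C`
  -- trivially.
  obtain ⟨C, hC⟩ := (A + B v₀).ker.exists_isCompl
  have hinj : ((A + B v₀) ∘ₗ C.subtype).ker = ⊥ := by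
    rw [LinearMap.ker_eq_bot']
    rintro ⟨x, hx⟩ h
    have : x ∈ (A + B v₀).ker ⊓ C := ⟨h, hx⟩
    rw [hC.inf_eq_bot] at this
    exact Subtype.ext this
  obtain ⟨L, hL⟩ := LinearMap.exists_leftInverse_of_injective _ hinj
  let b := finBasis ℝ C
  let Φ : (X →ₗ[ℝ] Y) →ₗ[ℝ] Matrix (Fin (finrank ℝ C)) (Fin (finrank ℝ C)) ℝ :=
    { toFun := fun T => LinearMap.toMatrix b b (L ∘ₗ T ∘ₗ C.subtype)
      map_add' := fun S T => by
        rw [LinearMap.add_comp, LinearMap.comp_add, map_add]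
      map_smul' := fun c T => by
        rw [LinearMap.smul_comp, LinearMap.comp_smul, map_smul]; rfl }
  refine ⟨fun v => (Φ (A + B v)).det, ?_, ?_, ?_, ?_⟩
  · refine Continuous.matrix_det (continuous_pi fun i => continuous_pi fun j => ?_)
    simp only [map_add, Matrix.add_apply]
    refine continuous_const.add ?_
    let ℓ : V →ₗ[ℝ] ℝ := (LinearMap.proj j ∘ₗ LinearMap.proj i) ∘ₗ
      (Φ ∘ₗ B : V →ₗ[ℝ] (Fin (finrank ℝ C) → Fin (finrank ℝ C) → ℝ))
    exact ℓ.continuous_of_finiteDimensional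
  · have : Φ (A + B v₀) = 1 := by
      change LinearMap.toMatrix b b (L ∘ₗ (A + B v₀) ∘ₗ C.subtype) = 1
      rw [hL, LinearMap.toMatrix_id]
    simp [this]
  · intro v hv
    have hdis : Disjoint (A + B v).ker C := by
      rw [Submodule.disjoint_def]
      intro x hx hxC
      have hdet : LinearMap.det (L ∘ₗ (A + B v) ∘ₗ C.subtype) ≠ 0 := by
        rwa [← LinearMap.det_toMatrix b]
      have hk := (LinearMap.isUnit_iff_ker_eq_bot _).1
        ((LinearMap.isUnit_iff_isUnit_det _).2 hdet.isUnit)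
      have : (⟨x, hxC⟩ : C) ∈ (L ∘ₗ (A + B v) ∘ₗ C.subtype).ker := by
        have hx' : (A + B v) x = 0 := hx
        change L ((A + B v) x) = 0
        rw [hx', map_zero]
      rw [hk] at this
      exact congrArg Subtype.val this
    have h1 := Submodule.finrank_add_finrank_le_of_disjoint hdis
    have h2 := Submodule.finrank_add_eq_of_isCompl hC
    omega
  · intro v w hv
    -- On a line the compressed matrix is affine in `t`, so its determinant is a polynomial in `t`,
    -- nonzero because it is nonzero at `t = 0`.
    let p : Polynomial ℝ := ((Polynomial.X : Polynomial ℝ) • (Φ (B w)).map Polynomial.C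
      + (Φ (A + B v)).map Polynomial.C).det
    have hp : ∀ t, p.eval t = (Φ (A + B (v + t • w))).det := by
      intro t
      change Polynomial.evalRingHom t _ = _
      rw [RingHom.map_det]
      congr 1
      ext i j
      simp
      ring
    have hp0 : p ≠ 0 := by
      intro h
      apply hv
      have := hp 0
      simpa [h] using this.symm
    refine (p.rootSet_finite ℝ).subset fun t ht => ?_
    rw [Polynomial.mem_rootSet]
    exact ⟨hp0, by rw [Polynomial.coe_aeval_eq_eval, hp]; exact ht⟩

/-! ### First-order conditions as a bound on one kernel. -/

section PolarForm

variable {V W : Type*} [AddCommGroup V] [Module ℂ V] [Module ℝ V] [IsScalarTower ℝ ℂ V]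
  [AddCommGroup W] [Module ℝ W]

/-- First-order uniqueness: the only directions in which the quadratic map `x ↦ D x x` is
stationary at `ψ` are the phase rotations. -/
def InfinitesimallyDetermined (D : V →ₗ[ℝ] V →ₗ[ℝ] W) (ψ : V) : Prop :=
  ∀ ξ, D ψ ξ = 0 → ∃ t : ℝ, ξ = t • (Complex.I • ψ)

/-- Only multiples `φ` of `ψ` have the property that the range of `D φ` lies in that of `D ψ`. -/
def RangeDetermined (D : V →ₗ[ℝ] V →ₗ[ℝ] W) (ψ : V) : Prop :=
  ∀ φ, (∀ η, ∃ ξ, D φ η = D ψ ξ) → ∃ a : ℂ, φ = a • ψ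

/-- The linear map whose kernel consists of the pairs `(φ, Λ)` with `D φ = D ψ ∘ Λ`. -/
def rangeComparison (D : V →ₗ[ℝ] V →ₗ[ℝ] W) :
    V →ₗ[ℝ] (V × (V →ₗ[ℝ] V)) →ₗ[ℝ] (V →ₗ[ℝ] W) where
  toFun ψ := (-LinearMap.llcomp ℝ V V W (D ψ)) ∘ₗ LinearMap.snd ℝ V (V →ₗ[ℝ] V)
  map_add' x y := LinearMap.ext fun p => LinearMap.ext fun η => by simp [add_comm]
  map_smul' c x := LinearMap.ext fun p => LinearMap.ext fun η => by simp

omit [Module ℂ V] [IsScalarTower ℝ ℂ V] in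
-- The system splits into a part independent of `ψ` and a part linear in `ψ`, the shape `A + B v` of
-- `exists_polynomial_finrank_ker_le`.
lemma mem_ker_rangeComparison {D : V →ₗ[ℝ] V →ₗ[ℝ] W} {ψ : V} {p : V × (V →ₗ[ℝ] V)} :
    p ∈ (D ∘ₗ LinearMap.fst ℝ V (V →ₗ[ℝ] V) + rangeComparison D ψ).ker ↔
      ∀ η, D p.1 η = D ψ (p.2 η) := by
  rw [LinearMap.mem_ker, LinearMap.ext_iff]
  refine forall_congr' fun η => ?_
  simp [rangeComparison, ← sub_eq_add_neg, sub_eq_zero]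

/-- The trivial solutions `(φ, Λ)` of `D φ = D ψ ∘ Λ`. -/
def trivialComparison (ψ : V) : (ℂ × (V →ₗ[ℝ] ℝ)) →ₗ[ℝ] V × (V →ₗ[ℝ] V) where
  toFun p := (p.1 • ψ,
    { toFun := fun η => (starRingEnd ℂ p.1) • η + p.2 η • (Complex.I • ψ)
      map_add' := fun x y => by simp only [smul_add, map_add, add_smul]; abel
      map_smul' := fun c x => by
        simp only [map_smul, RingHom.id_apply, smul_add, smul_assoc, smul_comm _ c x] })
  map_add' p q := by
    refine Prod.ext (add_smul _ _ _) (LinearMap.ext fun η => ?_)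
    simp only [Prod.fst_add, map_add, add_smul, Prod.snd_add, LinearMap.add_apply,
      LinearMap.coe_mk, AddHom.coe_mk]
    abel
  map_smul' c p := by
    refine Prod.ext (smul_assoc _ _ _) (LinearMap.ext fun η => ?_)
    change (starRingEnd ℂ (c • p.1)) • η + (c • p.2 η) • (Complex.I • ψ) =
      c • ((starRingEnd ℂ p.1) • η + p.2 η • (Complex.I • ψ))
    rw [smul_add, smul_assoc c (p.2 η), ← smul_assoc c (starRingEnd ℂ p.1)]
    simp

lemma trivialComparison_snd_apply (ψ η : V) (p : ℂ × (V →ₗ[ℝ] ℝ)) :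
    (trivialComparison ψ p).2 η = (starRingEnd ℂ p.1) • η + p.2 η • (Complex.I • ψ) := rfl

omit [Module ℝ V] [IsScalarTower ℝ ℂ V] in
lemma I_smul_ne_zero {ψ : V} (h : ψ ≠ 0) : Complex.I • ψ ≠ 0 :=
  smul_ne_zero Complex.I_ne_zero h

omit [IsScalarTower ℝ ℂ V] in
lemma smul_real_I_eq_zero {ψ : V} (h : ψ ≠ 0) {t : ℝ} (ht : t • (Complex.I • ψ) = 0) : t = 0 :=
  (smul_eq_zero.1 ht).resolve_right (I_smul_ne_zero h)

omit [IsScalarTower ℝ ℂ V] in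
lemma exists_functional_I_smul {ψ : V} (h : ψ ≠ 0) : ∃ g : V →ₗ[ℝ] ℝ, g (Complex.I • ψ) = 1 := by
  obtain ⟨g, hg⟩ := not_forall.1
    (mt (Module.forall_dual_apply_eq_zero_iff ℝ (Complex.I • ψ)).1 (I_smul_ne_zero h))
  exact ⟨(g (Complex.I • ψ))⁻¹ • g, by simp [hg]⟩

lemma trivialComparison_injective {ψ : V} (h : ψ ≠ 0) :
    Function.Injective (trivialComparison ψ) := by
  rw [← LinearMap.ker_eq_bot, LinearMap.ker_eq_bot']
  rintro ⟨a, t⟩ hp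
  have ha : a = 0 := (smul_eq_zero.1 (congrArg Prod.fst hp)).resolve_right h
  subst ha
  refine Prod.ext rfl (LinearMap.ext fun η => ?_)
  have := LinearMap.congr_fun (congrArg Prod.snd hp) η
  rw [trivialComparison_snd_apply] at this
  exact smul_real_I_eq_zero h (by simpa using this)

variable {D : V →ₗ[ℝ] V →ₗ[ℝ] W}

omit [IsScalarTower ℝ ℂ V] in
lemma polar_I_right (hI : ∀ x y, D (Complex.I • x) (Complex.I • y) = D x y) (x y : V) :
    D x (Complex.I • y) = - D (Complex.I • x) y := by
  rw [← hI x, smul_smul, Complex.I_mul_I, neg_one_smul, map_neg]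

/-- Invariance under `i` makes multiplication by `i` skew-adjoint for `D`, so the adjoint of `a` is
its conjugate. -/
lemma polar_smul_left (hI : ∀ x y, D (Complex.I • x) (Complex.I • y) = D x y) (a : ℂ) (x y : V) :
    D (a • x) y = D x ((starRingEnd ℂ a) • y) := by
  have h1 : ∀ (a : ℂ) (z : V), a • z = a.re • z + a.im • (Complex.I • z) := fun a z => by
    conv_lhs => rw [← Complex.re_add_im a, add_smul, mul_smul]
    simp [← algebraMap_smul ℂ (_ : ℝ)]
  rw [h1, h1 (starRingEnd ℂ a)]
  simp [polar_I_right hI x y]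

omit [IsScalarTower ℝ ℂ V] in
lemma polar_I_self (hs : ∀ x y, D x y = D y x)
    (hI : ∀ x y, D (Complex.I • x) (Complex.I • y) = D x y) (x : V) :
    D x (Complex.I • x) = 0 := by
  have h := polar_I_right hI x x
  rw [hs (Complex.I • x) x] at h
  have h2 : (2 : ℝ) • D x (Complex.I • x) = 0 := by
    rw [two_smul]; nth_rewrite 1 [h]; exact neg_add_cancel _
  exact (smul_eq_zero.1 h2).resolve_left two_ne_zero

lemma polar_smul_smul (hI : ∀ x y, D (Complex.I • x) (Complex.I • y) = D x y) (a : ℂ) (x y : V) :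
    D (a • x) (a • y) = (‖a‖ ^ 2 : ℝ) • D x y := by
  rw [polar_smul_left hI, smul_smul, Complex.conj_mul', ← map_smul, ← Complex.ofReal_pow,
    ← algebraMap_smul ℂ (‖a‖ ^ 2 : ℝ) y]
  rfl

lemma trivialComparison_mem_ker (hs : ∀ x y, D x y = D y x)
    (hI : ∀ x y, D (Complex.I • x) (Complex.I • y) = D x y) (ψ : V) (p : ℂ × (V →ₗ[ℝ] ℝ)) :
    trivialComparison ψ p ∈ (D ∘ₗ LinearMap.fst ℝ V (V →ₗ[ℝ] V) + rangeComparison D ψ).ker := by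
  rw [mem_ker_rangeComparison]
  intro η
  rw [trivialComparison_snd_apply, map_add, map_smul (D ψ), polar_I_self hs hI, smul_zero, add_zero]
  exact polar_smul_left hI _ _ _

variable [FiniteDimensional ℝ V]

omit [Module ℂ V] [IsScalarTower ℝ ℂ V] in
lemma finrank_complex_prod_dual : finrank ℝ (ℂ × (V →ₗ[ℝ] ℝ)) = finrank ℝ V + 2 := by
  rw [finrank_prod, Complex.finrank_real_complex, finrank_linearMap_self, add_comm]

/-- Every solution is trivial: the range condition gives `φ = a • ψ`, and then `Λ` minus
multiplication by `conj a` takes values in the kernel of `D ψ`, the phase line. The functional `g`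
reads off the coefficient on that line. -/
lemma finrank_ker_rangeComparison_le {ψ : V}
    (hI : ∀ x y, D (Complex.I • x) (Complex.I • y) = D x y) (hψ : ψ ≠ 0)
    (h1 : InfinitesimallyDetermined D ψ) (h2 : RangeDetermined D ψ) :
    finrank ℝ (D ∘ₗ LinearMap.fst ℝ V (V →ₗ[ℝ] V) + rangeComparison D ψ).ker ≤
      finrank ℝ V + 2 := by
  rw [← finrank_complex_prod_dual]
  refine le_trans (Submodule.finrank_mono ?_) (LinearMap.finrank_range_le (trivialComparison ψ))
  rintro ⟨φ, Λ⟩ hp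
  rw [mem_ker_rangeComparison] at hp
  obtain ⟨a, rfl⟩ := h2 φ fun η => ⟨Λ η, hp η⟩
  obtain ⟨g, hg⟩ := exists_functional_I_smul hψ
  let c : V →ₗ[ℝ] V :=
    { toFun := fun η => (starRingEnd ℂ a) • η
      map_add' := smul_add _
      map_smul' := fun r x => smul_comm _ _ _ }
  refine ⟨(a, g ∘ₗ (Λ - c)), Prod.ext rfl (LinearMap.ext fun η => ?_)⟩
  rw [trivialComparison_snd_apply]
  obtain ⟨t, ht⟩ := h1 (Λ η - c η) (by
    rw [map_sub, sub_eq_zero, ← hp]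
    exact polar_smul_left hI _ _ _)
  have : g (Λ η - c η) = t := by rw [ht, map_smul, hg, smul_eq_mul, mul_one]
  change c η + g (Λ η - c η) • _ = Λ η
  rw [this, ← ht]
  abel

/-- The trivial solutions always fill N + 2 dimensions, so the bound leaves room for no others. -/
lemma determined_of_finrank_ker_le {ψ : V} (hs : ∀ x y, D x y = D y x)
    (hI : ∀ x y, D (Complex.I • x) (Complex.I • y) = D x y) (hψ : ψ ≠ 0)
    (h : finrank ℝ (D ∘ₗ LinearMap.fst ℝ V (V →ₗ[ℝ] V) + rangeComparison D ψ).ker ≤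
      finrank ℝ V + 2) :
    InfinitesimallyDetermined D ψ ∧ RangeDetermined D ψ := by
  have hle : (trivialComparison ψ).range ≤
      (D ∘ₗ LinearMap.fst ℝ V (V →ₗ[ℝ] V) + rangeComparison D ψ).ker := by
    rintro _ ⟨p, rfl⟩
    exact trivialComparison_mem_ker hs hI ψ p
  have heq := Submodule.eq_of_le_of_finrank_le hle (by
    rw [LinearMap.finrank_range_of_inj (trivialComparison_injective hψ),
      finrank_complex_prod_dual]
    exact h)
  have key : ∀ φ (Λ : V →ₗ[ℝ] V), (∀ η, D φ η = D ψ (Λ η)) →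
      ∃ p, trivialComparison ψ p = (φ, Λ) := by
    intro φ Λ hΛ
    have : (φ, Λ) ∈ (trivialComparison ψ).range := by
      rw [heq, mem_ker_rangeComparison]; exact hΛ
    exact this
  constructor
  · intro ξ hξ
    obtain ⟨g, hg⟩ := exists_functional_I_smul hψ
    -- A kernel vector `ξ` of `D ψ` gives a solution with `φ = 0` and `Λ` of rank one; evaluating at
    -- `iψ` recovers `ξ`.
    obtain ⟨⟨a, t⟩, hp⟩ := key 0 (g.smulRight ξ) fun η => by simp [hξ]
    have ha : a = 0 := (smul_eq_zero.1 (congrArg Prod.fst hp)).resolve_right hψ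
    have := LinearMap.congr_fun (congrArg Prod.snd hp) (Complex.I • ψ)
    rw [trivialComparison_snd_apply, ha, map_zero, zero_smul, zero_add] at this
    refine ⟨t (Complex.I • ψ), ?_⟩
    simpa [hg] using this.symm
  · intro φ hφ
    choose Λ hΛ using hφ
    let b := finBasis ℝ V
    obtain ⟨⟨a, t⟩, hp⟩ := key φ (b.constr ℝ fun i => Λ (b i)) fun η => by
      have : D φ = D ψ ∘ₗ b.constr ℝ fun i => Λ (b i) :=
        b.ext fun i => by simp [hΛ]
      exact LinearMap.congr_fun this η
    exact ⟨a, (congrArg Prod.fst hp).symm⟩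

end PolarForm

/-! ### Tangent dimension at pairs with equal data. -/

section BadPairs

variable {V W : Type*} [AddCommGroup V] [Module ℂ V] [Module ℝ V] [IsScalarTower ℝ ℂ V]
  [AddCommGroup W] [Module ℝ W] [FiniteDimensional ℝ V] {D : V →ₗ[ℝ] V →ₗ[ℝ] W}

/-- The differential at `(ψ, φ)` of `(D φ φ - D ψ ψ) / 2`. -/
def pairDifferential (D : V →ₗ[ℝ] V →ₗ[ℝ] W) (ψ φ : V) : (V × V) →ₗ[ℝ] W :=
  D φ ∘ₗ LinearMap.snd ℝ V V - D ψ ∘ₗ LinearMap.fst ℝ V V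

omit [IsScalarTower ℝ ℂ V] in
-- Project the kernel to its second component. The image is proper, since otherwise the range
-- condition would make `φ` a multiple of `ψ`; the fibre is at most a line. The total is at most (N
-- - 1) + 1.
lemma finrank_ker_pairDifferential_le {ψ φ : V} (h1 : InfinitesimallyDetermined D ψ)
    (h2 : RangeDetermined D ψ) (hφ : ∀ a : ℂ, φ ≠ a • ψ) :
    finrank ℝ (pairDifferential D ψ φ).ker ≤ finrank ℝ V := by
  set K := (pairDifferential D ψ φ).ker
  let q : K →ₗ[ℝ] V := LinearMap.snd ℝ V V ∘ₗ K.subtype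
  have hK : ∀ p : V × V, p ∈ K ↔ D φ p.2 = D ψ p.1 := fun p => by
    rw [LinearMap.mem_ker, pairDifferential, LinearMap.sub_apply, sub_eq_zero]; rfl
  have hrange : finrank ℝ q.range < finrank ℝ V := by
    refine Submodule.finrank_lt fun htop => ?_
    obtain ⟨a, ha⟩ := h2 φ fun η => by
      have : η ∈ q.range := htop ▸ Submodule.mem_top
      obtain ⟨p, rfl⟩ := this
      exact ⟨p.1.1, (hK p.1).1 p.2⟩
    exact hφ a ha
  have hker : finrank ℝ q.ker ≤ 1 := by
    suffices h : ∃ v : q.ker, ∀ w : q.ker, ∃ c : ℝ, c • v = w from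
      finrank_le_one h.choose h.choose_spec
    -- Phase invariance is not assumed here; if `iψ` is not in the kernel of `D ψ`, the fibre is
    -- zero.
    by_cases hψ : D ψ (Complex.I • ψ) = 0
    · refine ⟨⟨⟨(Complex.I • ψ, 0), (hK _).2 (by simp [hψ])⟩, rfl⟩, ?_⟩
      rintro ⟨⟨⟨ξ, η⟩, hp⟩, hq⟩
      have hη : η = 0 := hq
      subst hη
      obtain ⟨t, ht⟩ := h1 ξ (by simpa using ((hK _).1 hp).symm)
      exact ⟨t, Subtype.ext (Subtype.ext (Prod.ext ht.symm (smul_zero _)))⟩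
    · refine ⟨0, ?_⟩
      rintro ⟨⟨⟨ξ, η⟩, hp⟩, hq⟩
      have hη : η = 0 := hq
      subst hη
      have h0 : D ψ ξ = 0 := by simpa using ((hK _).1 hp).symm
      obtain ⟨t, ht⟩ := h1 ξ h0
      refine ⟨0, ?_⟩
      have ht0 : t = 0 := by
        rw [ht, map_smul] at h0
        exact (smul_eq_zero.1 h0).resolve_right hψ
      refine Subtype.ext (Subtype.ext (Prod.ext ?_ ?_))
      · simp [ht, ht0]
      · simp
  have := q.finrank_range_add_finrank_ker
  omega

omit [IsScalarTower ℝ ℂ V] in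
-- Rotating the phase of `φ` always gives the kernel vector `(0, iφ)`. A functional not vanishing on
-- `iφ` excludes it, so the dimension drops strictly.
lemma finrank_ker_gauged_lt {ψ φ : V} (hs : ∀ x y, D x y = D y x)
    (hI : ∀ x y, D (Complex.I • x) (Complex.I • y) = D x y) (h1 : InfinitesimallyDetermined D ψ)
    (h2 : RangeDetermined D ψ) (hφ : ∀ a : ℂ, φ ≠ a • ψ) (f : V →ₗ[ℝ] ℝ)
    (hf : f (Complex.I • φ) ≠ 0) :
    finrank ℝ ((pairDifferential D ψ φ).prod (f ∘ₗ LinearMap.snd ℝ V V)).ker < finrank ℝ V := by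
  refine lt_of_lt_of_le (Submodule.finrank_lt_finrank_of_lt ?_)
    (finrank_ker_pairDifferential_le h1 h2 hφ)
  rw [LinearMap.ker_prod]
  refine lt_of_le_of_ne inf_le_left fun h => hf ?_
  have hmem : ((0, Complex.I • φ) : V × V) ∈ (pairDifferential D ψ φ).ker := by
    rw [LinearMap.mem_ker]
    simp [pairDifferential, polar_I_self hs hI]
  rw [← h] at hmem
  exact hmem.2

end BadPairs

/-! ### From one good point to almost every vector. -/

section AlmostEverywhere

variable {ι W : Type*} [Fintype ι] [NormedAddCommGroup W] [NormedSpace ℝ W]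
  {D : EuclideanSpace ℂ ι →ₗ[ℝ] EuclideanSpace ℂ ι →ₗ[ℝ] W}

lemma InfinitesimallyDetermined.smul {V W : Type*} [AddCommGroup V] [Module ℂ V] [Module ℝ V]
    [IsScalarTower ℝ ℂ V] [AddCommGroup W] [Module ℝ W] {D : V →ₗ[ℝ] V →ₗ[ℝ] W} {ψ : V}
    (h : InfinitesimallyDetermined D ψ) {c : ℝ} (hc : c ≠ 0) :
    InfinitesimallyDetermined D (c • ψ) := by
  intro ξ hξ
  rw [map_smul, LinearMap.smul_apply] at hξ
  obtain ⟨t, ht⟩ := h ξ ((smul_eq_zero.1 hξ).resolve_left hc)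
  refine ⟨t * c⁻¹, ?_⟩
  rw [ht, smul_comm Complex.I c, smul_smul, mul_assoc, inv_mul_cancel₀ hc, mul_one]

lemma RangeDetermined.smul {V W : Type*} [AddCommGroup V] [Module ℂ V] [Module ℝ V]
    [IsScalarTower ℝ ℂ V] [AddCommGroup W] [Module ℝ W] {D : V →ₗ[ℝ] V →ₗ[ℝ] W} {ψ : V}
    (h : RangeDetermined D ψ) {c : ℝ} (hc : c ≠ 0) : RangeDetermined D (c • ψ) := by
  intro φ hφ
  obtain ⟨a, ha⟩ := h φ fun η => by
    obtain ⟨ξ, hξ⟩ := hφ η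
    exact ⟨c • ξ, by rw [hξ, map_smul, map_smul, LinearMap.smul_apply]⟩
  refine ⟨a * (c : ℂ)⁻¹, ?_⟩
  have : (c : ℂ)⁻¹ • (c • ψ) = ψ := by
    rw [← algebraMap_smul ℂ c ψ, smul_smul]
    simp [hc]
  rw [mul_smul, this, ha]

/-- Both first-order conditions are generic as soon as they hold at one point. -/
lemma ae_determined (hs : ∀ x y, D x y = D y x)
    (hI : ∀ x y, D (Complex.I • x) (Complex.I • y) = D x y) {ψ₀ : EuclideanSpace ℂ ι}
    (hψ₀ : ψ₀ ≠ 0) (h1 : InfinitesimallyDetermined D ψ₀) (h2 : RangeDetermined D ψ₀) :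
    ∀ᵐ ψ : EuclideanSpace ℂ ι, InfinitesimallyDetermined D ψ ∧ RangeDetermined D ψ := by
  set N := finrank ℝ (EuclideanSpace ℂ ι)
  let r : EuclideanSpace ℂ ι → ℕ := fun ψ => finrank ℝ (D ∘ₗ LinearMap.fst ℝ _ _
    + rangeComparison D ψ).ker
  let s : Set (EuclideanSpace ℂ ι) := {ψ | r ψ ≤ N + 2}
  have hs_open : IsOpen s := by
    rw [isOpen_iff_mem_nhds]
    intro ψ hψ
    obtain ⟨f, hfc, hf0, hf, -⟩ := exists_polynomial_finrank_ker_le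
      (D ∘ₗ LinearMap.fst ℝ _ _) (rangeComparison D) ψ
    filter_upwards [hfc.continuousAt.eventually_ne hf0] with x hx
    exact (hf x hx).trans hψ
  have hmem : ψ₀ ∈ s := finrank_ker_rangeComparison_le hI hψ₀ h1 h2
  have hscale : ∀ ψ ∈ s, ψ ≠ 0 → ∀ c : ℝ, c ≠ 0 → c • ψ ∈ s := by
    intro ψ hψ hψ0 c hc
    obtain ⟨e1, e2⟩ := determined_of_finrank_ker_le hs hI hψ0 hψ
    exact finrank_ker_rangeComparison_le hI (smul_ne_zero hc hψ0) (e1.smul hc) (e2.smul hc)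
  have hae : ∀ᵐ ψ : EuclideanSpace ℂ ι, ψ ∈ s := by
    -- By Fubini it suffices to treat each line `x + ℝ ψ₀`. Openness puts `ψ₀ + c • x` in `s` for
    -- some small `c ≠ 0`; rescaling gives the point `x + c⁻¹ • ψ₀` of `s` on that line, and then
    -- only finitely many points of the line can fail.
    refine ae_mem_of_ae_add_linearMap_mem (LinearMap.toSpanSingleton ℝ _ ψ₀)
      (volume : Measure ℝ) volume hs_open.measurableSet fun x => ?_
    have hlim : Tendsto (fun c : ℝ => ψ₀ + c • x) (𝓝 0) (𝓝 ψ₀) := by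
      have : Continuous fun c : ℝ => ψ₀ + c • x := by fun_prop
      simpa using this.tendsto 0
    have hev : ∀ᶠ c in 𝓝[≠] (0 : ℝ), ψ₀ + c • x ∈ s ∧ ψ₀ + c • x ≠ 0 ∧ c ≠ 0 := by
      filter_upwards [(hlim.mono_left nhdsWithin_le_nhds).eventually (hs_open.mem_nhds hmem),
        (hlim.mono_left nhdsWithin_le_nhds).eventually_ne hψ₀, self_mem_nhdsWithin]
        with c a b e using ⟨a, b, e⟩
    obtain ⟨c, hc1, hc2, hc3⟩ := hev.exists
    have hc4 := hscale _ hc1 hc2 c⁻¹ (inv_ne_zero hc3)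
    rw [smul_add, smul_smul, inv_mul_cancel₀ hc3, one_smul, add_comm] at hc4
    obtain ⟨f, -, hf0, hf, hfin⟩ := exists_polynomial_finrank_ker_le
      (D ∘ₗ LinearMap.fst ℝ _ _) (rangeComparison D) (x + c⁻¹ • ψ₀)
    have hfin' := hfin (x + c⁻¹ • ψ₀) ψ₀ hf0
    have hnull : volume ((fun t => t + -c⁻¹) ⁻¹' {t : ℝ | f (x + c⁻¹ • ψ₀ + t • ψ₀) = 0}) = 0 := by
      rw [measure_preimage_add_right]
      exact hfin'.measure_zero _
    filter_upwards [measure_eq_zero_iff_ae_notMem.1 hnull] with t ht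
    have h3 := (hf _ ht).trans hc4
    have h4 : x + c⁻¹ • ψ₀ + (t + -c⁻¹) • ψ₀ = x + LinearMap.toSpanSingleton ℝ _ ψ₀ t := by
      rw [LinearMap.toSpanSingleton_apply, add_smul, neg_smul]; abel
    change r _ ≤ _
    rw [← h4]
    exact h3
  have hne : ∀ᵐ ψ : EuclideanSpace ℂ ι, ψ ≠ 0 := by
    have : Nontrivial (EuclideanSpace ℂ ι) := ⟨⟨ψ₀, 0, hψ₀⟩⟩
    exact Measure.ae_ne volume 0
  filter_upwards [hae, hne] with ψ h h'
  exact determined_of_finrank_ker_le hs hI h' h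

/-- If the two first-order conditions hold at one point, then almost every `ψ` is determined, up to
a scalar, by the value at `ψ` of the quadratic map with polar form `D`. -/
theorem ae_determined_of_polar (hs : ∀ x y, D x y = D y x)
    (hI : ∀ x y, D (Complex.I • x) (Complex.I • y) = D x y) {ψ₀ : EuclideanSpace ℂ ι}
    (hψ₀ : ψ₀ ≠ 0) (h1 : InfinitesimallyDetermined D ψ₀) (h2 : RangeDetermined D ψ₀) :
    ∀ᵐ ψ : EuclideanSpace ℂ ι, ∀ φ, D φ φ = D ψ ψ → ∃ a : ℂ, φ = a • ψ := by
  set N := finrank ℝ (EuclideanSpace ℂ ι)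
  let im : ι → EuclideanSpace ℂ ι →ₗ[ℝ] ℝ := fun i =>
    { toFun := fun x => (x i).im
      map_add' := fun x y => by simp
      map_smul' := fun c x => by simp }
  -- The last two conditions fix the phase of `φ`: its `i`-th coordinate is real and nonzero.
  let bad : ι → Set (EuclideanSpace ℂ ι × EuclideanSpace ℂ ι) := fun i =>
    {p | InfinitesimallyDetermined D p.1 ∧ RangeDetermined D p.1 ∧ (∀ a : ℂ, p.2 ≠ a • p.1) ∧
      D p.2 p.2 = D p.1 p.1 ∧ im i p.2 = 0 ∧ im i (Complex.I • p.2) ≠ 0}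
  let Dc : EuclideanSpace ℂ ι →L[ℝ] EuclideanSpace ℂ ι →L[ℝ] W :=
    LinearMap.toContinuousLinearMap
      ((LinearMap.toContinuousLinearMap : (_ →ₗ[ℝ] W) ≃ₗ[ℝ] _).toLinearMap ∘ₗ D)
  have hDc : ∀ x y, Dc x y = D x y := fun x y => rfl
  have hN : 0 < N := by
    have : Nontrivial (EuclideanSpace ℂ ι) := ⟨⟨ψ₀, 0, hψ₀⟩⟩
    exact finrank_pos
  have hbad : ∀ i, volume (Prod.fst '' bad i) = 0 := by
    intro i
    refine measure_eq_zero_of_dimH_lt_finrank _ ?_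
    refine lt_of_le_of_lt (LipschitzWith.prod_fst.dimH_image_le _) ?_
    let imc : EuclideanSpace ℂ ι →L[ℝ] ℝ := LinearMap.toContinuousLinearMap (im i)
    let F : EuclideanSpace ℂ ι × EuclideanSpace ℂ ι → W × ℝ := fun p =>
      (Dc p.2 p.2 - Dc p.1 p.1, imc p.2)
    let F' : EuclideanSpace ℂ ι × EuclideanSpace ℂ ι →
        EuclideanSpace ℂ ι × EuclideanSpace ℂ ι →L[ℝ] W × ℝ := fun p =>
      ((2 : ℝ) • (Dc p.2 ∘L ContinuousLinearMap.snd ℝ _ _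
        - Dc p.1 ∘L ContinuousLinearMap.fst ℝ _ _)).prod (imc ∘L ContinuousLinearMap.snd ℝ _ _)
    have hF : ∀ p, HasStrictFDerivAt F (F' p) p := by
      intro p
      have hq : ∀ x : EuclideanSpace ℂ ι,
          HasStrictFDerivAt (fun y => Dc y y) ((2 : ℝ) • Dc x) x := by
        intro x
        have := Dc.hasStrictFDerivAt_of_bilinear (hasStrictFDerivAt_id x) (hasStrictFDerivAt_id x)
        convert! this using 1
        ext y
        simp [two_smul, hDc, hs y x]
      refine HasStrictFDerivAt.prodMk ?_
        (imc.hasStrictFDerivAt.comp p hasStrictFDerivAt_snd)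
      have := ((hq p.2).comp p hasStrictFDerivAt_snd).sub
        ((hq p.1).comp p hasStrictFDerivAt_fst)
      convert! this using 1
      rw [smul_sub]
      rfl
    have hdim : dimH (bad i) ≤ (N - 1 : ℕ) := by
      refine dimH_le_of_finrank_ker_le (F := F) (F' := F') (fun p _ => hF p) ?_ ?_
      · rintro p ⟨-, -, -, h4, h5, -⟩
        exact Prod.ext (by simp [F, hDc, h4]) h5
      · rintro p ⟨e1, e2, e3, -, -, e6⟩
        have hker : (F' p).ker = ((pairDifferential D p.1 p.2).prod
            (im i ∘ₗ LinearMap.snd ℝ _ _)).ker := by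
          ext x
          rw [LinearMap.ker_prod, Submodule.mem_inf]
          change ((2 : ℝ) • (D p.2 x.2 - D p.1 x.1), im i x.2) = (0, 0) ↔
            D p.2 x.2 - D p.1 x.1 = 0 ∧ im i x.2 = 0
          rw [Prod.mk_inj, smul_eq_zero_iff_right two_ne_zero]
        have := finrank_ker_gauged_lt hs hI e1 e2 e3 (im i) e6
        rw [hker]
        omega
    refine lt_of_le_of_lt hdim ?_
    exact_mod_cast Nat.sub_lt hN one_pos
  have hae : ∀ᵐ ψ : EuclideanSpace ℂ ι, ∀ i, ψ ∉ Prod.fst '' bad i :=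
    ae_all_iff.2 fun i => measure_eq_zero_iff_ae_notMem.1 (hbad i)
  filter_upwards [hae, ae_determined hs hI hψ₀ h1 h2] with ψ hψ hdet φ hφ
  by_contra! hne
  have hφ0 : φ ≠ 0 := fun h => hne 0 (by simp [h])
  obtain ⟨i, hi⟩ : ∃ i, φ i ≠ 0 := by
    by_contra! h
    exact hφ0 (PiLp.ext h)
  have hn : (‖φ i‖ : ℂ) ≠ 0 := by simpa using hi
  -- This phase turns the nonzero coordinate `φ i` into `‖φ i‖`, moving `φ` into the gauge of `bad
  -- i`.
  set z : ℂ := (starRingEnd ℂ (φ i)) / ‖φ i‖ with hz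
  have hz1 : ‖z‖ = 1 := by
    rw [hz, norm_div, RCLike.norm_conj]; simpa using hi
  have hz0 : z ≠ 0 := by
    rw [← norm_ne_zero_iff, hz1]; exact one_ne_zero
  have hzφ : (z • φ) i = (‖φ i‖ : ℂ) := by
    rw [PiLp.smul_apply, smul_eq_mul, hz, div_mul_eq_mul_div, Complex.conj_mul']
    field_simp
  refine hψ i ⟨(ψ, z • φ), ⟨hdet.1, hdet.2, ?_, ?_, ?_, ?_⟩, rfl⟩
  · intro a ha
    refine hne (z⁻¹ * a) ?_
    rw [mul_smul, ← (show z • φ = a • ψ from ha), smul_smul, inv_mul_cancel₀ hz0, one_smul]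
  · change D (z • φ) (z • φ) = D ψ ψ
    rw [polar_smul_smul hI, hz1, one_pow, one_smul, hφ]
  · change ((z • φ) i).im = 0
    rw [hzφ]; simp
  · change ((Complex.I • z • φ) i).im ≠ 0
    rw [PiLp.smul_apply, hzφ]
    simpa using hi

end AlmostEverywhere

/-- A property that is almost everywhere true in the space and only depends on the direction is
almost everywhere true on the unit sphere. -/
lemma ae_toSphere_of_ae {E : Type*} [NormedAddCommGroup E] [NormedSpace ℝ E]
    [FiniteDimensional ℝ E] [MeasurableSpace E] [BorelSpace E] (μ : Measure E)
    [μ.IsAddHaarMeasure] {P : E → Prop} (hP : ∀ᵐ x ∂μ, P x)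
    (hscale : ∀ x (r : ℝ), 0 < r → P (r • x) → P x) :
    ∀ᵐ x : Metric.sphere (0 : E) 1 ∂μ.toSphere, P x := by
  have h1 : ∀ᵐ y : ({0}ᶜ : Set E) ∂(μ.comap Subtype.val), P y := by
    rw [ae_iff] at hP ⊢
    rw [MeasurableEmbedding.comap_apply
      (MeasurableEmbedding.subtype_coe (measurableSet_singleton (0 : E)).compl)]
    exact measure_mono_null (by rintro _ ⟨y, hy, rfl⟩; exact hy) hP
  have mp := μ.measurePreserving_homeomorphUnitSphereProd
  have h2 : ∀ᵐ q ∂(μ.toSphere.prod (Measure.volumeIoiPow (finrank ℝ E - 1))),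
      P ((homeomorphUnitSphereProd E).symm q) := by
    rw [← mp.map_eq, (homeomorphUnitSphereProd E).measurableEmbedding.ae_map_iff]
    simpa using h1
  filter_upwards [Measure.ae_ae_of_ae_prod h2] with x hx
  -- The radial measure is nonzero, since `(0, 1)` has positive mass; so an almost-everywhere
  -- statement about radii holds for at least one radius.
  have : (ae (Measure.volumeIoiPow (finrank ℝ E - 1))).NeBot := by
    rw [ae_neBot]
    intro h0
    have := Measure.volumeIoiPow_apply_Iio (finrank ℝ E - 1) ⟨1, mem_Ioi.2 one_pos⟩
    rw [h0] at this
    simp at this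
    have h0 : (0 : ℝ) ≤ (finrank ℝ E - 1 : ℕ) := Nat.cast_nonneg _
    linarith
  obtain ⟨r, hr⟩ := hx.exists
  exact hscale x r r.2 (by simpa using hr)

/-! ### Linear systems governed by one dominant weight. -/

section DominantWeights

open ComplexConjugate

variable {G : Type*} [AddCommGroup G] [DecidableEq G]

/-- Weights of a diagonal tensor, dominated by the weight `Λ` at `0`. -/
noncomputable def dominantWeight (Λ : ℝ) (μ : G → ℝ) (i : G) : ℂ :=
  if i = 0 then Λ else μ i * (1 + Complex.I)

variable {Λ : ℝ} {μ : G → ℝ}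

lemma dominantWeight_zero : dominantWeight Λ μ 0 = Λ := if_pos rfl

lemma dominantWeight_of_ne {i : G} (hi : i ≠ 0) :
    dominantWeight Λ μ i = μ i * (1 + Complex.I) := if_neg hi

lemma norm_sq_dominantWeight_of_ne {i : G} (hi : i ≠ 0) :
    ‖dominantWeight Λ μ i‖ ^ 2 = 2 * μ i ^ 2 := by
  rw [dominantWeight_of_ne hi, ← Complex.normSq_eq_norm_sq]
  simp [Complex.normSq_apply]
  ring

variable (hμ1 : ∀ i, 1 ≤ μ i) (hμ2 : ∀ i, μ i ≤ 2)
include hμ1 hμ2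

lemma norm_dominantWeight_mem {i : G} (hi : i ≠ 0) :
    1 ≤ ‖dominantWeight Λ μ i‖ ∧ ‖dominantWeight Λ μ i‖ ≤ 3 := by
  have h := norm_sq_dominantWeight_of_ne (Λ := Λ) (μ := μ) hi
  have h1 := hμ1 i
  have h2 := hμ2 i
  have h3 := norm_nonneg (dominantWeight Λ μ i)
  constructor <;> nlinarith

lemma dominantWeight_ne_zero (hΛ : 3 < Λ) (i : G) : dominantWeight Λ μ i ≠ 0 := by
  by_cases hi : i = 0
  · subst hi
    rw [dominantWeight_zero, Ne, Complex.ofReal_eq_zero]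
    linarith
  · rw [← norm_ne_zero_iff]
    have := norm_dominantWeight_mem hμ1 hμ2 (Λ := Λ) hi
    linarith

lemma norm_sq_dominantWeight_injective (hΛ : 3 < Λ) (hμ : Function.Injective μ) :
    Function.Injective fun i => ‖dominantWeight Λ μ i‖ ^ 2 := by
  have h0 : ‖dominantWeight Λ μ 0‖ = Λ := by
    rw [dominantWeight_zero, Complex.norm_real, Real.norm_eq_abs, abs_of_pos (by linarith)]
  have hne : ∀ i : G, i ≠ 0 → ‖dominantWeight Λ μ i‖ ^ 2 < Λ ^ 2 := by
    intro i hi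
    have := norm_dominantWeight_mem hμ1 hμ2 (Λ := Λ) hi
    nlinarith
  intro i j hij
  simp only at hij
  by_cases hi : i = 0 <;> by_cases hj : j = 0
  · rw [hi, hj]
  · have := hne j hj
    rw [hi, h0] at hij
    linarith
  · have := hne i hi
    rw [hj, h0] at hij
    linarith
  · rw [norm_sq_dominantWeight_of_ne hi, norm_sq_dominantWeight_of_ne hj] at hij
    have h1 := hμ1 i
    have h2 := hμ1 j
    exact hμ (by nlinarith)

/-- Take `r` maximizing `|η r|`. The two terms of size `Λ` carry the factors `1 - i` and `1 + i`,
while all others are real; this is why the small weights have phase `1 + i`. The imaginary part ties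
the two large terms together, and the real part then equates `2 Λ μ r η r` with a sum of bounded
terms. -/
lemma phase_eq_zero_of_dominantWeight [Fintype G] (hΛ : 8 * Fintype.card G < Λ) (η : G → ℝ)
    (h0 : η 0 = 0)
    (h : ∀ r ≠ 0, ∑ j, dominantWeight Λ μ j * conj (dominantWeight Λ μ (j + r)) *
      ((η (j + r) - η j : ℝ) : ℂ) = 0) (r : G) : η r = 0 := by
  obtain ⟨r₀, -, hr₀⟩ := Finset.exists_max_image Finset.univ (fun i => |η i|) ⟨0, Finset.mem_univ _⟩
  replace hr₀ : ∀ i, |η i| ≤ |η r₀| := fun i => hr₀ i (Finset.mem_univ i)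
  suffices hM : |η r₀| = 0 from abs_eq_zero.1 (le_antisymm (hM ▸ hr₀ r) (abs_nonneg _))
  by_cases hr : r₀ = 0
  · simp [hr, h0]
  set M := |η r₀|
  have hM0 : 0 ≤ M := abs_nonneg _
  have hcard : (1 : ℝ) ≤ Fintype.card G := by exact_mod_cast Fintype.card_pos
  set f : G → ℂ := fun j => dominantWeight Λ μ j * conj (dominantWeight Λ μ (j + r₀)) *
      ((η (j + r₀) - η j : ℝ) : ℂ) with hf
  have hsum := h r₀ hr
  change ∑ j, f j = 0 at hsum
  set S := (Finset.univ.erase (0 : G)).erase (-r₀)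
  have hsplit : f 0 + (f (-r₀) + ∑ j ∈ S, f j) = 0 := by
    rw [Finset.add_sum_erase _ f (by simp [hr]), Finset.add_sum_erase _ f (Finset.mem_univ _), hsum]
  have hmem : ∀ j ∈ S, j ≠ 0 ∧ j + r₀ ≠ 0 := by
    intro j hj
    simp only [S, Finset.mem_erase, Finset.mem_univ, and_true] at hj
    exact ⟨hj.2, fun h => hj.1 (eq_neg_of_add_eq_zero_left h)⟩
  have hf0 : f 0 = (Λ * μ r₀ * η r₀ : ℝ) * (1 - Complex.I) := by
    simp only [hf, zero_add, h0, sub_zero, dominantWeight_zero, dominantWeight_of_ne hr, map_mul,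
      Complex.conj_ofReal, map_add, map_one, Complex.conj_I]
    push_cast
    ring
  have hfr : f (-r₀) = -(Λ * μ (-r₀) * η (-r₀) : ℝ) * (1 + Complex.I) := by
    simp only [hf, neg_add_cancel, h0, zero_sub, dominantWeight_zero,
      dominantWeight_of_ne (neg_ne_zero.2 hr), Complex.conj_ofReal]
    push_cast
    ring
  have hfS : ∀ j ∈ S, f j = ((2 * μ j * μ (j + r₀) * (η (j + r₀) - η j) : ℝ) : ℂ) := by
    intro j hj
    obtain ⟨h1, h2⟩ := hmem j hj
    simp only [hf, dominantWeight_of_ne h1, dominantWeight_of_ne h2, map_mul,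
      Complex.conj_ofReal, map_add, map_one, Complex.conj_I]
    push_cast
    linear_combination (-(μ j : ℂ) * μ (j + r₀) * (η (j + r₀) - η j)) * Complex.I_mul_I
  rw [Finset.sum_congr rfl hfS, ← Complex.ofReal_sum, hf0, hfr] at hsplit
  have hre := congrArg Complex.re hsplit
  have him := congrArg Complex.im hsplit
  simp at hre him
  -- Each term is at most `2 * 2 * 2` times `2 * M`. Against `2 * Λ * M` this is what the threshold
  -- `8 * card` beats.
  have hbound : |∑ j ∈ S, 2 * μ j * μ (j + r₀) * (η (j + r₀) - η j)| ≤
      Fintype.card G * (16 * M) := by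
    refine (Finset.abs_sum_le_sum_abs _ _).trans ?_
    refine (Finset.sum_le_card_nsmul S _ (16 * M) fun j _ => ?_).trans ?_
    · rw [abs_mul, abs_of_nonneg (by have := hμ1 j; have := hμ1 (j + r₀); positivity)]
      have hd : |η (j + r₀) - η j| ≤ 2 * M :=
        (abs_sub _ _).trans (by linarith [hr₀ j, hr₀ (j + r₀)])
      have hp : 2 * μ j * μ (j + r₀) ≤ 8 := by
        nlinarith [hμ1 j, hμ1 (j + r₀), hμ2 j, hμ2 (j + r₀)]
      calc _ ≤ 8 * (2 * M) := by gcongr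
        _ = 16 * M := by ring
    · rw [nsmul_eq_mul]
      gcongr
      exact_mod_cast Finset.card_le_univ S
  have hkey : |2 * (Λ * μ r₀ * η r₀)| ≤ Fintype.card G * (16 * M) := by
    rw [← abs_neg]
    convert hbound using 2
    linarith
  have h1 := hμ1 r₀
  have hΛ0 : 0 < Λ := by linarith
  rw [abs_mul, abs_mul, abs_of_pos (two_pos), abs_of_pos (by positivity)] at hkey
  by_contra hMne
  have hMpos : 0 < M := lt_of_le_of_ne hM0 (Ne.symm hMne)
  have : Λ * M ≤ Λ * μ r₀ * M := by nlinarith [mul_pos hΛ0 hMpos]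
  nlinarith

/-- At `k` maximizing `‖y k‖` the left side is of order `Λ ^ 2` and the right side of order `Λ`, so
the maximum vanishes. A third index `j` is needed to have an equation at `k`. -/
lemma ratio_eq_zero_of_dominantWeight [Finite G] (hΛ : 12 ≤ Λ)
    (hG : ∀ k : G, k ≠ 0 → ∃ j, j ≠ 0 ∧ j ≠ k) (y : G → ℂ) (h0 : y 0 = 0)
    (h : ∀ j k, j ≠ 0 → k ≠ 0 → j ≠ k → ∃ p q : ℂ, ‖p‖ = 1 ∧ ‖q‖ = 1 ∧
      y k * (dominantWeight Λ μ k * p *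
        (‖dominantWeight Λ μ j‖ ^ 2 - ‖dominantWeight Λ μ 0‖ ^ 2 : ℝ)) =
      y j * (p * dominantWeight Λ μ k * (‖dominantWeight Λ μ j‖ ^ 2 : ℝ) -
        q * conj (dominantWeight Λ μ (j - k)) * (dominantWeight Λ μ 0 * dominantWeight Λ μ j)))
    (k : G) : y k = 0 := by
  obtain ⟨k₀, hk₀⟩ := Finite.exists_max fun i => ‖y i‖
  suffices hM : ‖y k₀‖ = 0 from norm_eq_zero.1 (le_antisymm (hM ▸ hk₀ k) (norm_nonneg _))
  by_cases hk : k₀ = 0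
  · simp [hk, h0]
  obtain ⟨j, hj0, hjk⟩ := hG k₀ hk
  obtain ⟨p, q, hp, hq, heq⟩ := h j k₀ hj0 hk hjk
  have hn0 : ‖dominantWeight Λ μ 0‖ = Λ := by
    rw [dominantWeight_zero, Complex.norm_real, Real.norm_eq_abs, abs_of_pos (by linarith)]
  obtain ⟨hj1, hj3⟩ := norm_dominantWeight_mem hμ1 hμ2 (Λ := Λ) hj0
  obtain ⟨hk1, hk3⟩ := norm_dominantWeight_mem hμ1 hμ2 (Λ := Λ) hk
  obtain ⟨hl1, hl3⟩ := norm_dominantWeight_mem hμ1 hμ2 (Λ := Λ) (sub_ne_zero.2 hjk)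
  set a := ‖dominantWeight Λ μ k₀‖
  set b := ‖dominantWeight Λ μ j‖
  set c := ‖dominantWeight Λ μ (j - k₀)‖
  have hl := congrArg norm heq
  rw [norm_mul, norm_mul, norm_mul, hp, Complex.norm_real, hn0, Real.norm_eq_abs,
    abs_sub_comm, abs_of_nonneg (by nlinarith)] at hl
  have hr : ‖p * dominantWeight Λ μ k₀ * (b ^ 2 : ℝ) -
      q * conj (dominantWeight Λ μ (j - k₀)) * (dominantWeight Λ μ 0 * dominantWeight Λ μ j)‖ ≤
      a * b ^ 2 + c * (Λ * b) := by
    refine (norm_sub_le _ _).trans (le_of_eq ?_)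
    simp only [norm_mul, hp, hq, RCLike.norm_conj, hn0, Complex.norm_real, Real.norm_eq_abs,
      abs_of_nonneg (sq_nonneg b), one_mul]
    rfl
  have hmax := hk₀ j
  rw [norm_mul] at hl
  set M := ‖y k₀‖
  have hM0 : 0 ≤ M := norm_nonneg _
  have hle : M * (a * 1 * (Λ ^ 2 - b ^ 2)) ≤ M * (a * b ^ 2 + c * (Λ * b)) := by
    rw [hl]
    exact mul_le_mul hmax hr (norm_nonneg _) hM0
  by_contra hMne
  have hMpos : 0 < M := lt_of_le_of_ne hM0 (Ne.symm hMne)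
  have h1 := le_of_mul_le_mul_left hle hMpos
  have hb9 : b ^ 2 ≤ 9 := by nlinarith
  have hcb : c * b ≤ 9 := by nlinarith
  have h2 : c * (Λ * b) ≤ 9 * Λ := by nlinarith
  have h3 : a * b ^ 2 ≤ a * 9 := by gcongr
  have h4 : a * (Λ ^ 2 - 9) ≤ a * 1 * (Λ ^ 2 - b ^ 2) := by
    rw [mul_one]; gcongr
  -- At `Λ = 12` this reads 108 < 126.
  have h5 : 9 * Λ < Λ ^ 2 - 18 := by nlinarith
  nlinarith

end DominantWeights

/-! ### First-order conditions at a diagonal tensor. -/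

section TwistedShift

open ComplexConjugate

variable {G : Type*} [AddCommGroup G] [DecidableEq G] [Fintype G]

/-- The correlation of `x` with the twisted shift of `y` by `(r, s)`. -/
def twistedCorrelation (χ : G → G → ℂ) (r s : G) (x y : G → G → ℂ) : ℂ :=
  ∑ i, ∑ j, χ r i * conj (χ s j) * x i j * conj (y (i + r) (j + s))

/-- The matrix with diagonal `w`. -/
def diagonalTensor (w : G → ℂ) (i j : G) : ℂ := if i = j then w i else 0

lemma twistedCorrelation_diagonal_left (χ : G → G → ℂ) (r s : G) (w : G → ℂ) (y : G → G → ℂ) :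
    twistedCorrelation χ r s (diagonalTensor w) y =
      ∑ i, χ r i * conj (χ s i) * w i * conj (y (i + r) (i + s)) := by
  refine Finset.sum_congr rfl fun i _ => ?_
  rw [Finset.sum_eq_single i]
  · simp [diagonalTensor]
  · intro j _ hj
    simp [diagonalTensor, hj.symm]
  · simp

omit [AddCommGroup G] [Fintype G] in
-- The system in `u` and `v` has determinant `‖a‖ ^ 2 - ‖b‖ ^ 2`.
lemma pair_eq_zero_of_norm_ne {a b u v : ℂ} (hab : ‖a‖ ^ 2 ≠ ‖b‖ ^ 2)
    (h1 : a * u + v * conj b = 0) (h2 : u * b + conj a * v = 0) : u = 0 ∧ v = 0 := by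
  have hd : (conj a * a - conj b * b : ℂ) ≠ 0 := by
    rw [Complex.conj_mul', Complex.conj_mul', sub_ne_zero]
    exact_mod_cast hab
  constructor
  · refine (mul_eq_zero.1 (?_ : (conj a * a - conj b * b) * u = 0)).resolve_left hd
    linear_combination conj a * h1 - conj b * h2
  · refine (mul_eq_zero.1 (?_ : (conj a * a - conj b * b) * v = 0)).resolve_left hd
    linear_combination a * h2 - b * h1

variable {χ : G → G → ℂ} {w : G → ℂ}

/-- Stationarity of both Gram matrices kills the off-diagonal entries, because the `‖w i‖` are
distinct, and makes the diagonal ones purely phase-like, `i θ w`. The correlations with equal shifts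
then force `θ` to be constant. -/
lemma diagonalTensor_infinitesimal
    (hχ : ∀ r i, conj (χ r i) * χ r i = 1) (hw : ∀ i, w i ≠ 0)
    (hwinj : Function.Injective fun i => ‖w i‖ ^ 2)
    (hphase : ∀ η : G → ℝ, η 0 = 0 →
      (∀ r ≠ 0, ∑ j, w j * conj (w (j + r)) * ((η (j + r) - η j : ℝ) : ℂ) = 0) → ∀ r, η r = 0)
    (ξ : G → G → ℂ)
    (hL : ∀ i j, w i * conj (ξ j i) + ξ i j * conj (w j) = 0)
    (hR : ∀ i j, conj (ξ j i) * w j + conj (w i) * ξ i j = 0)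
    (hT : ∀ r, twistedCorrelation χ r r (diagonalTensor w) ξ +
      twistedCorrelation χ r r ξ (diagonalTensor w) = 0) :
    ∃ t : ℝ, ∀ i j, ξ i j = t * (Complex.I * diagonalTensor w i j) := by
  have hoff : ∀ i j, i ≠ j → ξ i j = 0 := fun i j hij =>
    (pair_eq_zero_of_norm_ne (hwinj.ne hij) (hL i j) (hR i j)).2
  let θ : G → ℝ := fun i => (ξ i i / w i).im
  have hθ : ∀ i, ξ i i = Complex.I * θ i * w i := by
    intro i
    have h1 := hL i i
    have h2 : (ξ i i / w i).re = 0 := by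
      have h3 : ξ i i / w i + conj (ξ i i / w i) = 0 := by
        have hc : conj (w i) ≠ 0 := (map_ne_zero _).2 (hw i)
        rw [map_div₀]
        field_simp [hw i]
        linear_combination h1
      rw [Complex.add_conj] at h3
      simpa using h3
    have h4 : ξ i i / w i = Complex.I * θ i := by
      apply Complex.ext <;> simp [h2, θ]
    rw [← h4, div_mul_cancel₀ _ (hw i)]
  have hξ : ξ = diagonalTensor fun i => Complex.I * θ i * w i := by
    funext i j
    by_cases hij : i = j
    · subst hij; simp [diagonalTensor, hθ i]
    · simp [diagonalTensor, hij, hoff i j hij]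
  have hconst : ∀ r, θ r - θ 0 = 0 := by
    refine hphase (fun r => θ r - θ 0) (sub_self _) fun r _ => ?_
    have h := hT r
    rw [hξ, twistedCorrelation_diagonal_left, twistedCorrelation_diagonal_left,
      ← Finset.sum_add_distrib] at h
    have h2 : ∀ i, χ r i * conj (χ r i) = 1 := fun i => by rw [mul_comm, hχ]
    simp only [diagonalTensor, if_true, h2, one_mul, map_mul, Complex.conj_I,
      Complex.conj_ofReal] at h
    have h3 : ∑ j, -Complex.I * (w j * conj (w (j + r)) *
        (((θ (j + r) - θ 0) - (θ j - θ 0) : ℝ) : ℂ)) = 0 := by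
      rw [← h]
      refine Finset.sum_congr rfl fun j _ => ?_
      push_cast
      ring
    rw [← Finset.mul_sum] at h3
    exact (mul_eq_zero.1 h3).resolve_left (neg_ne_zero.2 Complex.I_ne_zero)
  refine ⟨θ 0, fun i j => ?_⟩
  rw [hξ]
  by_cases hij : i = j
  · subst hij
    simp only [diagonalTensor, if_true, sub_eq_zero.1 (hconst i)]
    ring
  · simp [diagonalTensor, hij]

/-- The elementary matrix at `(i, j)`. -/
def elementaryTensor (i j a b : G) : ℂ := if a = i ∧ b = j then 1 else 0

/-- Testing on elementary matrices suffices: `(i, j)` with `i ≠ j` kills the off-diagonal entries of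
`x`, and `(0, j)` compares the ratios `x i i / w i`. -/
lemma diagonalTensor_range
    (hχ : ∀ r i, conj (χ r i) * χ r i = 1) (hw : ∀ i, w i ≠ 0)
    (hwinj : Function.Injective fun i => ‖w i‖ ^ 2)
    (hratio : ∀ y : G → ℂ, y 0 = 0 → (∀ j k, j ≠ 0 → k ≠ 0 → j ≠ k →
      ∃ p q : ℂ, ‖p‖ = 1 ∧ ‖q‖ = 1 ∧
        y k * (w k * p * (‖w j‖ ^ 2 - ‖w 0‖ ^ 2 : ℝ)) =
        y j * (p * w k * (‖w j‖ ^ 2 : ℝ) - q * conj (w (j - k)) * (w 0 * w j))) → ∀ k, y k = 0)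
    (x : G → G → ℂ)
    (h : ∀ η : G → G → ℂ, ∃ ℓ m : G → G → ℂ,
      (∀ a b, ∑ c, x a c * conj (η b c) = w a * conj (ℓ b a) + m a b * conj (w b)) ∧
      (∀ a b, ∑ c, conj (η c a) * x c b = conj (ℓ b a) * w b + conj (w a) * m a b) ∧
      ∀ r s, twistedCorrelation χ r s x η = twistedCorrelation χ r s (diagonalTensor w) ℓ +
        twistedCorrelation χ r s m (diagonalTensor w)) :
    ∃ a : ℂ, ∀ i j, x i j = a * diagonalTensor w i j := by
  have hoff : ∀ i j, i ≠ j → x i j = 0 := by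
    intro i j hij
    obtain ⟨ℓ, m, hA, hB, -⟩ := h (elementaryTensor i j)
    have h1 := hA i i
    have h2 := hB i i
    -- At `(i, i)` both Gram equations have the same right side, while their left sides are `x i j`
    -- and 0.
    simp [elementaryTensor, hij] at h1 h2
    rw [h1]
    linear_combination -h2
  have hx : x = diagonalTensor fun i => x i i := by
    funext i j
    by_cases hij : i = j
    · subst hij; simp [diagonalTensor]
    · simp [diagonalTensor, hij, hoff i j hij]
  set y : G → ℂ := fun i => x i i / w i with hy
  have hxy : ∀ i, x i i = w i * y i := fun i => by
    rw [hy]; field_simp [hw i]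
  have hyc : ∀ k, y k - y 0 = 0 := by
    refine hratio (fun k => y k - y 0) (sub_self _) fun j k hj hk hjk => ?_
    obtain ⟨ℓ, m, hA, hB, hC⟩ := h (elementaryTensor 0 j)
    -- Away from the diagonal only the entries `ℓ 0 j` and `m j 0` survive. The shift `(-k, j - k)`
    -- below never meets the diagonals of `ℓ` and `m`, as `j ≠ 0`, so it isolates these two entries
    -- and `x k k`.
    have hzero : ∀ a b, a ≠ b → ¬ (a = j ∧ b = 0) → conj (ℓ b a) = 0 ∧ m a b = 0 := by
      intro a b hab hne
      refine pair_eq_zero_of_norm_ne (hwinj.ne hab) ?_ ?_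
      · rw [← hA a b]
        refine Finset.sum_eq_zero fun c _ => ?_
        by_cases hc : b = 0 ∧ c = j
        · have : a ≠ c := fun hac => hne ⟨hac.trans hc.2, hc.1⟩
          rw [hoff a c this, zero_mul]
        · simp [elementaryTensor, hc]
      · rw [← hB a b]
        refine Finset.sum_eq_zero fun c _ => ?_
        by_cases hc : c = 0 ∧ a = j
        · have : c ≠ b := fun hcb => hne ⟨hc.2, hcb.symm.trans hc.1⟩
          rw [hoff c b this, mul_zero]
        · simp [elementaryTensor, hc]
    have hL := hA j 0
    have hR := hB j 0
    simp [elementaryTensor] at hL hR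
    set L := conj (ℓ 0 j)
    set M := m j 0
    have hC' := hC (-k) (j - k)
    have e1 : twistedCorrelation χ (-k) (j - k) x (elementaryTensor 0 j) =
        χ (-k) k * conj (χ (j - k) k) * x k k := by
      rw [hx, twistedCorrelation_diagonal_left, Finset.sum_eq_single k]
      · simp [elementaryTensor, diagonalTensor]
      · intro i _ hi
        have : ¬ (i + -k = 0) := fun h => hi (by rwa [← sub_eq_add_neg, sub_eq_zero] at h)
        simp [elementaryTensor, this]
      · simp
    have e2 : twistedCorrelation χ (-k) (j - k) (diagonalTensor w) ℓ =
        χ (-k) k * conj (χ (j - k) k) * w k * L := by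
      rw [twistedCorrelation_diagonal_left, Finset.sum_eq_single k]
      · simp [L]
      · intro i _ hi
        have h1 : i + (j - k) ≠ i + -k := fun h => hj (by
          have := add_left_cancel h
          rwa [sub_eq_add_neg, add_eq_right] at this)
        have h2 : ¬ (i + (j - k) = j ∧ i + -k = 0) := fun h =>
          hi (by have := h.2; rwa [← sub_eq_add_neg, sub_eq_zero] at this)
        rw [(hzero _ _ h1 h2).1, mul_zero]
      · simp
    have e3 : twistedCorrelation χ (-k) (j - k) m (diagonalTensor w) =
        χ (-k) j * conj (χ (j - k) 0) * M * conj (w (j - k)) := by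
      unfold twistedCorrelation
      rw [Finset.sum_eq_single j, Finset.sum_eq_single 0]
      · simp [diagonalTensor, sub_eq_add_neg, M]
      · intro b _ hb
        have : j + -k ≠ b + (j - k) := fun h => hb (by
          rw [← sub_eq_add_neg] at h; exact (right_eq_add.1 h))
        simp [diagonalTensor, this]
      · simp
      · intro a _ ha
        refine Finset.sum_eq_zero fun b _ => ?_
        by_cases hab : a + -k = b + (j - k)
        · have h1 : a = b + j := by
            have : a = b + (j - k) + k := by rw [← hab]; abel
            rw [this]; abel
          have h2 : a ≠ b := fun h => hj (by rw [h] at h1; exact left_eq_add.1 h1)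
          rw [(hzero a b h2 fun h => ha h.1).2]
          simp
        · simp [diagonalTensor, hab]
      · simp
    rw [e1, e2, e3, hxy] at hC'
    have hnorm : ∀ r i, ‖χ r i‖ = 1 := fun r i => by
      have := hχ r i
      rw [Complex.conj_mul'] at this
      have h' : ‖χ r i‖ ^ 2 = 1 := by exact_mod_cast this
      exact (pow_eq_one_iff_of_nonneg (norm_nonneg _) two_ne_zero).1 h'
    refine ⟨χ (-k) k * conj (χ (j - k) k), χ (-k) j * conj (χ (j - k) 0), by simp [hnorm],
      by simp [hnorm], ?_⟩
    push_cast
    rw [← Complex.conj_mul', ← Complex.conj_mul']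
    rw [hxy] at hL hR
    set p := χ (-k) k * conj (χ (j - k) k)
    set q := χ (-k) j * conj (χ (j - k) 0)
    clear_value y
    -- Cramer's rule: `L` and `M` are eliminated from the correlation equation using the two Gram
    -- equations.
    linear_combination (conj (w j) * w j - conj (w 0) * w 0) * hC' -
      p * w k * (conj (w j) * hL - conj (w 0) * hR) - q * conj (w (j - k)) * (w j * hR - w 0 * hL)
  refine ⟨y 0, fun i j => ?_⟩
  by_cases hij : i = j
  · subst hij
    rw [hxy, sub_eq_zero.1 (hyc i)]
    simp [diagonalTensor, mul_comm]
  · simp [diagonalTensor, hij, hoff i j hij]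

end TwistedShift

/-! ### Weyl operators in the Bell basis. -/

section BellBasis

open ComplexConjugate Matrix

variable (d : ℕ) [NeZero d]

/-- The phase `e^{2πi r₂ i₁ / d}` picked up when Weyl operators are multiplied. -/
noncomputable def weylPhase (r i : ZMod d × ZMod d) : ℂ := ZMod.stdAddChar (r.2 * i.1)

/-- The (unnormalized) Bell basis of two qudits; `(p, q)` labels the column
`∑ a, e^{2πi q a / d} |a, a + p⟩`. -/
noncomputable def bellMatrix : Matrix (ZMod d × ZMod d) (ZMod d × ZMod d) ℂ :=
  fun x i => if x.2 = x.1 + i.1 then ZMod.stdAddChar (i.2 * x.1) else 0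

/-- The Weyl operator `r` on the second of two qudits. -/
noncomputable def localWeyl (r : ZMod d × ZMod d) :
    Matrix (ZMod d × ZMod d) (ZMod d × ZMod d) ℂ :=
  fun y x => if y.1 = x.1 ∧ y.2 = x.2 + r.1 then ZMod.stdAddChar (r.2 * x.2) else 0

/-- The Weyl operator `r` in the Bell basis: a twisted shift. -/
noncomputable def twistedShift (r : ZMod d × ZMod d) :
    Matrix (ZMod d × ZMod d) (ZMod d × ZMod d) ℂ :=
  fun k i => if k = i + r then weylPhase d r i else 0

variable {d}

lemma conj_stdAddChar (a : ZMod d) :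
    conj (ZMod.stdAddChar a : ℂ) = ZMod.stdAddChar (-a) :=
  (AddChar.map_neg_eq_conj _ _).symm

lemma conj_weylPhase_mul (r i : ZMod d × ZMod d) :
    conj (weylPhase d r i) * weylPhase d r i = 1 := by
  rw [weylPhase, conj_stdAddChar, ← AddChar.map_add_eq_mul, neg_add_cancel, AddChar.map_zero_eq_one]

lemma bellMatrix_mul_conjTranspose : bellMatrix d * (bellMatrix d)ᴴ = (d : ℂ) • 1 := by
  ext ⟨a, b⟩ ⟨a', b'⟩
  rw [mul_apply, Fintype.sum_prod_type, Finset.sum_eq_single (b - a)]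
  · have h : ∀ q : ZMod d, bellMatrix d (a, b) (b - a, q) * (bellMatrix d)ᴴ (b - a, q) (a', b') =
        (if b' = a' + (b - a) then 1 else 0) * ZMod.stdAddChar (q * (a - a')) := by
      intro q
      by_cases hb : b' = a' + (b - a)
      · rw [if_pos hb]
        simp only [conjTranspose_apply, bellMatrix, add_sub_cancel, if_true, if_pos hb]
        rw [← starRingEnd_apply, conj_stdAddChar, ← AddChar.map_add_eq_mul, one_mul]
        congr 1
        ring
      · simp [bellMatrix, hb]
    rw [Finset.sum_congr rfl fun q _ => h q, ← Finset.mul_sum,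
      AddChar.sum_mulShift _ (ZMod.isPrimitive_stdAddChar d), ZMod.card, Matrix.smul_apply, one_apply]
    by_cases haa : a = a'
    · subst haa
      by_cases hbb : b = b'
      · subst hbb; simp
      · have : ¬ b' = b := fun h => hbb h.symm
        simp [hbb, this]
    · simp [haa, sub_eq_zero]
  · intro p _ hp
    refine Finset.sum_eq_zero fun q _ => ?_
    have : ¬ b = a + p := fun h => hp (by rw [h]; ring)
    simp [bellMatrix, this]
  · simp

lemma natCast_ne_zero_of_neZero : (d : ℂ) ≠ 0 := Nat.cast_ne_zero.2 (NeZero.ne d)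

lemma conjTranspose_mul_bellMatrix : (bellMatrix d)ᴴ * bellMatrix d = (d : ℂ) • 1 := by
  have hd := natCast_ne_zero_of_neZero (d := d)
  have h : bellMatrix d * ((d : ℂ)⁻¹ • (bellMatrix d)ᴴ) = 1 := by
    rw [Matrix.mul_smul, bellMatrix_mul_conjTranspose, smul_smul, inv_mul_cancel₀ hd, one_smul]
  rw [mul_eq_one_comm] at h
  rw [← h, Matrix.smul_mul, smul_smul, mul_inv_cancel₀ hd, one_smul]

/-- A Weyl operator on one qudit permutes the Bell vectors up to phases. This turns correlations on
B and D into shifts of the Bell labels. -/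
lemma localWeyl_mul_bellMatrix (r : ZMod d × ZMod d) :
    localWeyl d r * bellMatrix d = bellMatrix d * twistedShift d r := by
  ext ⟨a, b⟩ i
  rw [mul_apply, mul_apply, Finset.sum_eq_single (a, b - r.1), Finset.sum_eq_single (i + r)]
  · simp only [localWeyl, bellMatrix, twistedShift, sub_add_cancel, and_self, if_true, weylPhase,
      Prod.fst_add, Prod.snd_add]
    by_cases h : b = a + (i.1 + r.1)
    · rw [if_pos (by rw [h]; ring), if_pos h, ← AddChar.map_add_eq_mul, ← AddChar.map_add_eq_mul]
      congr 1
      rw [h]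
      ring
    · rw [if_neg (fun h' => h (by rw [← add_assoc, ← h']; ring)), if_neg h]
      simp
  · intro k _ hk
    simp [twistedShift, hk]
  · simp
  · rintro ⟨x, y⟩ _ hxy
    have : ¬ (a = x ∧ b = y + r.1) := fun h => hxy (by rw [h.1, h.2]; simp)
    simp [localWeyl, this]
  · simp

lemma twistedShift_mul_conjTranspose (r : ZMod d × ZMod d) :
    twistedShift d r * (bellMatrix d)ᴴ = (bellMatrix d)ᴴ * localWeyl d r := by
  have hd := natCast_ne_zero_of_neZero (d := d)
  have h : (bellMatrix d)ᴴ * (localWeyl d r * bellMatrix d) * (bellMatrix d)ᴴ =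
      (bellMatrix d)ᴴ * (bellMatrix d * twistedShift d r) * (bellMatrix d)ᴴ := by
    rw [localWeyl_mul_bellMatrix]
  rw [← Matrix.mul_assoc, Matrix.mul_assoc _ (bellMatrix d), bellMatrix_mul_conjTranspose,
    ← Matrix.mul_assoc, conjTranspose_mul_bellMatrix, Matrix.smul_mul, Matrix.smul_mul, Matrix.mul_smul,
    Matrix.mul_one, Matrix.one_mul] at h
  exact (smul_right_injective _ hd h).symm

lemma sum_add_right {H : Type*} [Fintype H] [AddGroup H] (f : H → ℂ) (t : H) :
    ∑ i, f (i + t) = ∑ i, f i :=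
  Equiv.sum_comp (Equiv.addRight t) f

lemma twistedCorrelation_eq_trace (r s : ZMod d × ZMod d)
    (x y : Matrix (ZMod d × ZMod d) (ZMod d × ZMod d) ℂ) :
    twistedCorrelation (weylPhase d) r s x y =
      (twistedShift d r * x * (twistedShift d s)ᴴ * yᴴ).trace := by
  have h : ∀ i j, (twistedShift d r * x * (twistedShift d s)ᴴ) (i + r) (j + s) =
      weylPhase d r i * conj (weylPhase d s j) * x i j := by
    intro i j
    rw [mul_apply, Finset.sum_eq_single j, mul_apply, Finset.sum_eq_single i]
    · simp [twistedShift]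
      ring
    · intro k _ hk
      simp [twistedShift, hk.symm]
    · simp
    · intro k _ hk
      simp [twistedShift, hk.symm]
    · simp
  rw [trace, ← sum_add_right _ r]
  refine Finset.sum_congr rfl fun i _ => ?_
  rw [diag_apply, mul_apply]
  refine Eq.trans ?_ (sum_add_right _ s)
  refine Finset.sum_congr rfl fun j _ => ?_
  simp only [h, conjTranspose_apply]
  rfl

/-- The inner sums over `a` and `c` trace out A and C, so for `y = x` the trace depends only on the
BD marginal. -/
lemma trace_localWeyl (r s : ZMod d × ZMod d)
    (x y : Matrix (ZMod d × ZMod d) (ZMod d × ZMod d) ℂ) :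
    (localWeyl d r * x * (localWeyl d s)ᴴ * yᴴ).trace =
      ∑ b, ∑ e, ZMod.stdAddChar (r.2 * b) * conj (ZMod.stdAddChar (s.2 * e)) *
        ∑ a, ∑ c, x (a, b) (c, e) * conj (y (a, b + r.1) (c, e + s.1)) := by
  have h : ∀ a b c e, (localWeyl d r * x * (localWeyl d s)ᴴ) (a, b + r.1) (c, e + s.1) =
      ZMod.stdAddChar (r.2 * b) * conj (ZMod.stdAddChar (s.2 * e) : ℂ) * x (a, b) (c, e) := by
    intro a b c e
    rw [mul_apply, Finset.sum_eq_single (c, e), mul_apply, Finset.sum_eq_single (a, b)]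
    · simp [localWeyl]
      ring
    · rintro ⟨a', b'⟩ _ hk
      have : ¬ (a = a' ∧ b = b') := fun h => hk (by rw [h.1, h.2])
      simp [localWeyl, this]
    · simp
    · rintro ⟨a', b'⟩ _ hk
      have : ¬ (c = a' ∧ e = b') := fun h => hk (by rw [h.1, h.2])
      simp [localWeyl, this]
    · simp
  have h1 : (localWeyl d r * x * (localWeyl d s)ᴴ * yᴴ).trace = ∑ a, ∑ b, ∑ c, ∑ e,
      ZMod.stdAddChar (r.2 * b) * conj (ZMod.stdAddChar (s.2 * e) : ℂ) *
        (x (a, b) (c, e) * conj (y (a, b + r.1) (c, e + s.1))) := by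
    rw [trace, Fintype.sum_prod_type]
    refine Finset.sum_congr rfl fun a _ => ?_
    rw [← sum_add_right _ r.1]
    refine Finset.sum_congr rfl fun b _ => ?_
    rw [diag_apply, mul_apply, Fintype.sum_prod_type]
    refine Finset.sum_congr rfl fun c _ => ?_
    rw [← sum_add_right _ s.1]
    refine Finset.sum_congr rfl fun e _ => ?_
    simp only [h, conjTranspose_apply, mul_assoc]
    rfl
  rw [h1, Finset.sum_comm]
  refine Finset.sum_congr rfl fun b _ => ?_
  simp only [Finset.mul_sum]
  rw [Finset.sum_comm' (t' := Finset.univ) (s' := fun _ => Finset.univ) (by simp)]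
  rw [Finset.sum_congr rfl fun c _ => Finset.sum_comm]
  rw [Finset.sum_comm]
  exact Finset.sum_congr rfl fun e _ => Finset.sum_comm

end BellBasis

/-! ### Marginals of four qudits as Gram data. -/

section FourQudits

open ComplexConjugate Matrix

/-- Summation over the labels of the two parties outside `S`. -/
lemma sum_compl_pair {n d : ℕ} (S : Finset (Fin n)) (p q : Fin n) (hpq : p ≠ q)
    (hS : ∀ k, k ∉ S ↔ k = p ∨ k = q) (F : ({i // i ∉ S} → Fin d) → ℂ) :
    ∑ c, F c = ∑ x, ∑ y, F fun i => if i.1 = p then x else y := by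
  rw [← Fintype.sum_prod_type']
  let e : ({i // i ∉ S} → Fin d) ≃ Fin d × Fin d :=
    { toFun := fun c => (c ⟨p, (hS p).2 (Or.inl rfl)⟩, c ⟨q, (hS q).2 (Or.inr rfl)⟩)
      invFun := fun x i => if i.1 = p then x.1 else x.2
      left_inv := fun c => by
        funext ⟨i, hi⟩
        rcases (hS i).1 hi with rfl | rfl
        · simp
        · simp [hpq.symm]
      right_inv := fun x => by simp [hpq.symm] }
  exact (Equiv.sum_comp e.symm F).symm

/-- The sesquilinear data of a pair of bipartite tensors: the two one-sided Gram matrices and the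
twisted correlations. -/
noncomputable def gramData (d : ℕ) [NeZero d]
    (x y : ZMod d × ZMod d → ZMod d × ZMod d → ℂ) :
    (ZMod d × ZMod d → ZMod d × ZMod d → ℂ) × (ZMod d × ZMod d → ZMod d × ZMod d → ℂ) ×
      (ZMod d × ZMod d → ZMod d × ZMod d → ℂ) :=
  (fun a b => ∑ c, x a c * conj (y b c), fun a b => ∑ c, conj (y c a) * x c b,
    fun r s => twistedCorrelation (weylPhase d) r s x y)

variable {d : ℕ} [NeZero d]

lemma gramData_add_left (x x' y : ZMod d × ZMod d → ZMod d × ZMod d → ℂ) :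
    gramData d (x + x') y = gramData d x y + gramData d x' y := by
  refine Prod.ext ?_ (Prod.ext ?_ ?_) <;> funext a b <;>
  simp [gramData, twistedCorrelation, add_mul, mul_add, Finset.sum_add_distrib]

lemma gramData_add_right (x y y' : ZMod d × ZMod d → ZMod d × ZMod d → ℂ) :
    gramData d x (y + y') = gramData d x y + gramData d x y' := by
  refine Prod.ext ?_ (Prod.ext ?_ ?_) <;> funext a b <;>
  simp [gramData, twistedCorrelation, add_mul, mul_add, Finset.sum_add_distrib]

lemma gramData_smul_left (c : ℂ) (x y : ZMod d × ZMod d → ZMod d × ZMod d → ℂ) :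
    gramData d (c • x) y = c • gramData d x y := by
  refine Prod.ext ?_ (Prod.ext ?_ ?_) <;> funext a b <;>
  simp [gramData, twistedCorrelation, Finset.mul_sum, mul_assoc, mul_left_comm]

lemma gramData_smul_right (c : ℂ) (x y : ZMod d × ZMod d → ZMod d × ZMod d → ℂ) :
    gramData d x (c • y) = conj c • gramData d x y := by
  refine Prod.ext ?_ (Prod.ext ?_ ?_) <;> funext a b <;>
  simp [gramData, twistedCorrelation, Finset.mul_sum, mul_assoc, mul_left_comm]

variable (d) in
/-- The label in `Fin d` of an element of `ZMod d`. -/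
def zmodLabel : ZMod d ≃ Fin d := (ZMod.finEquiv d).symm.toEquiv

/-- The coefficient matrix of a four-party vector in the bipartition `AB|CD`. -/
def pairMatrix (ψ : Qudits 4 d) : Matrix (ZMod d × ZMod d) (ZMod d × ZMod d) ℂ :=
  fun x y => ψ ![zmodLabel d x.1, zmodLabel d x.2, zmodLabel d y.1, zmodLabel d y.2]

variable (d) in
/-- Passage to (unnormalized) Bell coordinates on both sides of `AB|CD`. -/
noncomputable def bellCoords :
    Qudits 4 d ≃ₗ[ℂ] (ZMod d × ZMod d → ZMod d × ZMod d → ℂ) where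
  toFun ψ := (bellMatrix d)ᴴ * pairMatrix ψ * bellMatrix d
  map_add' ψ φ := by
    have : pairMatrix (ψ + φ) = pairMatrix ψ + pairMatrix φ := rfl
    rw [this, Matrix.mul_add, Matrix.add_mul]
    rfl
  map_smul' c ψ := by
    have : pairMatrix (c • ψ) = c • pairMatrix ψ := rfl
    rw [this, Matrix.mul_smul, Matrix.smul_mul]
    rfl
  invFun x := WithLp.toLp 2 fun f =>
    (((d : ℂ)⁻¹ * (d : ℂ)⁻¹) • (bellMatrix d * Matrix.of x * (bellMatrix d)ᴴ))
      ((zmodLabel d).symm (f 0), (zmodLabel d).symm (f 1))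
      ((zmodLabel d).symm (f 2), (zmodLabel d).symm (f 3))
  left_inv ψ := by
    have hd := natCast_ne_zero_of_neZero (d := d)
    have h : ((d : ℂ)⁻¹ * (d : ℂ)⁻¹) • (bellMatrix d *
        ((bellMatrix d)ᴴ * pairMatrix ψ * bellMatrix d) * (bellMatrix d)ᴴ) = pairMatrix ψ := by
      have h1 : bellMatrix d * ((bellMatrix d)ᴴ * pairMatrix ψ * bellMatrix d) * (bellMatrix d)ᴴ =
          (bellMatrix d * (bellMatrix d)ᴴ) * pairMatrix ψ * (bellMatrix d * (bellMatrix d)ᴴ) := by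
        simp only [Matrix.mul_assoc]
      rw [h1, bellMatrix_mul_conjTranspose]
      simp only [Matrix.smul_mul, Matrix.mul_smul, Matrix.one_mul, Matrix.mul_one, smul_smul]
      field_simp
      exact one_smul _ _
    refine PiLp.ext fun f => ?_
    refine (congrFun (congrFun h _) _).trans ?_
    simp only [pairMatrix, Equiv.apply_symm_apply]
    exact congrArg (fun g => ψ g) (by funext i; fin_cases i <;> rfl)
  right_inv x := by
    have hd := natCast_ne_zero_of_neZero (d := d)
    set N : Matrix (ZMod d × ZMod d) (ZMod d × ZMod d) ℂ :=
      ((d : ℂ)⁻¹ * (d : ℂ)⁻¹) • (bellMatrix d * Matrix.of x * (bellMatrix d)ᴴ) with hN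
    have h : pairMatrix (WithLp.toLp 2 fun f : Fin 4 → Fin d =>
        N ((zmodLabel d).symm (f 0), (zmodLabel d).symm (f 1))
          ((zmodLabel d).symm (f 2), (zmodLabel d).symm (f 3))) = N := by
      ext ⟨a, b⟩ ⟨c, e⟩
      simp [pairMatrix]
    change (bellMatrix d)ᴴ * pairMatrix (WithLp.toLp 2 fun f : Fin 4 → Fin d =>
        N ((zmodLabel d).symm (f 0), (zmodLabel d).symm (f 1))
          ((zmodLabel d).symm (f 2), (zmodLabel d).symm (f 3))) * bellMatrix d = Matrix.of x
    rw [h, hN]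
    have h1 : (bellMatrix d)ᴴ * (bellMatrix d * Matrix.of x * (bellMatrix d)ᴴ) *
        bellMatrix d = ((bellMatrix d)ᴴ * bellMatrix d) * Matrix.of x *
          ((bellMatrix d)ᴴ * bellMatrix d) := by
      simp only [Matrix.mul_assoc]
    rw [Matrix.mul_smul, Matrix.smul_mul, h1, conjTranspose_mul_bellMatrix]
    simp only [Matrix.smul_mul, Matrix.mul_smul, Matrix.one_mul, Matrix.mul_one, smul_smul]
    field_simp
    exact one_smul _ _

omit [NeZero d] in
lemma glue_label {S : Finset (Fin 4)} {s : {i // i ∈ S} → Fin d} {c : {i // i ∉ S} → Fin d}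
    {f : Fin 4 → Fin d} (h1 : ∀ i, s i = f i) (h2 : ∀ i, c i = f i) : glue S s c = f := by
  funext i
  unfold glue
  split
  · exact h1 _
  · exact h2 _

/-- The values of `f` and `g` at the traced parties `p` and `q` are overwritten, so later uses fill
those slots arbitrarily. -/
lemma marginal_density_eq (S : Finset (Fin 4)) (p q : Fin 4) (hpq : p ≠ q)
    (hS : ∀ k, k ∉ S ↔ k = p ∨ k = q) (ψ : PureVec 4 d) (f g : Fin 4 → Fin d) :
    marginal S (density ψ) (fun i => f i) (fun i => g i) =
      ∑ x : ZMod d, ∑ y : ZMod d,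
        (ψ : Qudits 4 d) (Function.update (Function.update f p (zmodLabel d x)) q (zmodLabel d y)) *
        conj ((ψ : Qudits 4 d)
          (Function.update (Function.update g p (zmodLabel d x)) q (zmodLabel d y))) := by
  have hg : ∀ (f : Fin 4 → Fin d) (x y : Fin d),
      glue S (fun i => f i) (fun i => if i.1 = p then x else y) =
        Function.update (Function.update f p x) q y := by
    intro f x y
    refine glue_label (fun i => ?_) fun i => ?_
    · have h1 : i.1 ≠ p := fun h => ((hS i.1).2 (Or.inl h)) i.2
      have h2 : i.1 ≠ q := fun h => ((hS i.1).2 (Or.inr h)) i.2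
      rw [Function.update_of_ne h2, Function.update_of_ne h1]
    · rcases (hS i.1).1 i.2 with h | h
      · rw [if_pos h, h, Function.update_of_ne hpq, Function.update_self]
      · rw [if_neg (fun h' => hpq (h'.symm.trans h)), h, Function.update_self]
  rw [marginal, sum_compl_pair S p q hpq hS]
  rw [← Equiv.sum_comp (zmodLabel d)]
  refine Finset.sum_congr rfl fun x _ => ?_
  rw [← Equiv.sum_comp (zmodLabel d)]
  refine Finset.sum_congr rfl fun y _ => ?_
  rw [density, hg, hg]
  rfl

lemma pairMatrix_mul_conjTranspose_congr {φ ψ : PureVec 4 d}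
    (h : marginal {0, 1} (density φ) = marginal {0, 1} (density ψ)) :
    pairMatrix (φ : Qudits 4 d) * (pairMatrix (φ : Qudits 4 d))ᴴ =
      pairMatrix (ψ : Qudits 4 d) * (pairMatrix (ψ : Qudits 4 d))ᴴ := by
  have key : ∀ (χ : PureVec 4 d) (a b a' b' : ZMod d),
      (pairMatrix (χ : Qudits 4 d) * (pairMatrix (χ : Qudits 4 d))ᴴ) (a, b) (a', b') =
      marginal {0, 1} (density χ)
        (fun i => ![zmodLabel d a, zmodLabel d b, zmodLabel d a, zmodLabel d b] i)
        (fun i => ![zmodLabel d a', zmodLabel d b', zmodLabel d a', zmodLabel d b'] i) := by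
    intro χ a b a' b'
    rw [marginal_density_eq _ 2 3 (by decide) (by decide), mul_apply, Fintype.sum_prod_type]
    refine Finset.sum_congr rfl fun x _ => Finset.sum_congr rfl fun y _ => ?_
    simp only [conjTranspose_apply, pairMatrix]
    exact congrArg₂ (fun u v => (χ : Qudits 4 d) u * conj ((χ : Qudits 4 d) v))
      (by funext i; fin_cases i <;> rfl) (by funext i; fin_cases i <;> rfl)
  ext ⟨a, b⟩ ⟨a', b'⟩
  rw [key, key, h]

lemma conjTranspose_mul_pairMatrix_congr {φ ψ : PureVec 4 d}
    (h : marginal {2, 3} (density φ) = marginal {2, 3} (density ψ)) :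
    (pairMatrix (φ : Qudits 4 d))ᴴ * pairMatrix (φ : Qudits 4 d) =
      (pairMatrix (ψ : Qudits 4 d))ᴴ * pairMatrix (ψ : Qudits 4 d) := by
  have key : ∀ (χ : PureVec 4 d) (a b a' b' : ZMod d),
      ((pairMatrix (χ : Qudits 4 d))ᴴ * pairMatrix (χ : Qudits 4 d)) (a', b') (a, b) =
      marginal {2, 3} (density χ)
        (fun i => ![zmodLabel d a, zmodLabel d b, zmodLabel d a, zmodLabel d b] i)
        (fun i => ![zmodLabel d a', zmodLabel d b', zmodLabel d a', zmodLabel d b'] i) := by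
    intro χ a b a' b'
    rw [marginal_density_eq _ 0 1 (by decide) (by decide), mul_apply, Fintype.sum_prod_type]
    refine Finset.sum_congr rfl fun x _ => Finset.sum_congr rfl fun y _ => ?_
    simp only [conjTranspose_apply, pairMatrix]
    rw [mul_comm]
    exact congrArg₂ (fun u v => (χ : Qudits 4 d) u * conj ((χ : Qudits 4 d) v))
      (by funext i; fin_cases i <;> rfl) (by funext i; fin_cases i <;> rfl)
  ext ⟨a, b⟩ ⟨a', b'⟩
  rw [key, key, h]

lemma sum_pairMatrix_congr {φ ψ : PureVec 4 d}
    (h : marginal {1, 3} (density φ) = marginal {1, 3} (density ψ)) (b e b' e' : ZMod d) :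
    ∑ a, ∑ c, pairMatrix (φ : Qudits 4 d) (a, b) (c, e) *
        conj (pairMatrix (φ : Qudits 4 d) (a, b') (c, e')) =
      ∑ a, ∑ c, pairMatrix (ψ : Qudits 4 d) (a, b) (c, e) *
        conj (pairMatrix (ψ : Qudits 4 d) (a, b') (c, e')) := by
  have key : ∀ χ : PureVec 4 d, ∑ a, ∑ c, pairMatrix (χ : Qudits 4 d) (a, b) (c, e) *
        conj (pairMatrix (χ : Qudits 4 d) (a, b') (c, e')) =
      marginal {1, 3} (density χ)
        (fun i => ![zmodLabel d b, zmodLabel d b, zmodLabel d b, zmodLabel d e] i)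
        (fun i => ![zmodLabel d b', zmodLabel d b', zmodLabel d b', zmodLabel d e'] i) := by
    intro χ
    rw [marginal_density_eq _ 0 2 (by decide) (by decide)]
    refine Finset.sum_congr rfl fun x _ => Finset.sum_congr rfl fun y _ => ?_
    simp only [pairMatrix]
    exact congrArg₂ (fun u v => (χ : Qudits 4 d) u * conj ((χ : Qudits 4 d) v))
      (by funext i; fin_cases i <;> rfl) (by funext i; fin_cases i <;> rfl)
  rw [key, key, h]

/-- The marginals on `AB`, `CD` and `BD` determine the Gram data in Bell coordinates. -/
lemma gramData_bellCoords_congr {φ ψ : PureVec 4 d}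
    (hAB : marginal {0, 1} (density φ) = marginal {0, 1} (density ψ))
    (hCD : marginal {2, 3} (density φ) = marginal {2, 3} (density ψ))
    (hBD : marginal {1, 3} (density φ) = marginal {1, 3} (density ψ)) :
    gramData d (bellCoords d φ) (bellCoords d φ) = gramData d (bellCoords d ψ) (bellCoords d ψ) := by
  set U := bellMatrix d
  -- Since `U * Uᴴ = d`, passing to Bell coordinates only conjugates and rescales the Gram matrices.
  have e1 : ∀ P : Matrix (ZMod d × ZMod d) (ZMod d × ZMod d) ℂ,
      (Uᴴ * P * U) * (Uᴴ * P * U)ᴴ = (d : ℂ) • (Uᴴ * (P * Pᴴ) * U) := by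
    intro P
    have : (Uᴴ * P * U) * (Uᴴ * P * U)ᴴ = Uᴴ * P * (U * Uᴴ) * Pᴴ * U := by
      simp only [conjTranspose_mul, conjTranspose_conjTranspose, Matrix.mul_assoc]
    rw [this, bellMatrix_mul_conjTranspose]
    simp only [Matrix.smul_mul, Matrix.mul_smul, Matrix.mul_one, Matrix.mul_assoc]
  have e2 : ∀ P : Matrix (ZMod d × ZMod d) (ZMod d × ZMod d) ℂ,
      (Uᴴ * P * U)ᴴ * (Uᴴ * P * U) = (d : ℂ) • (Uᴴ * (Pᴴ * P) * U) := by
    intro P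
    have : (Uᴴ * P * U)ᴴ * (Uᴴ * P * U) = Uᴴ * Pᴴ * (U * Uᴴ) * P * U := by
      simp only [conjTranspose_mul, conjTranspose_conjTranspose, Matrix.mul_assoc]
    rw [this, bellMatrix_mul_conjTranspose]
    simp only [Matrix.smul_mul, Matrix.mul_smul, Matrix.mul_one, Matrix.mul_assoc]
  have e3 : ∀ (P : Matrix (ZMod d × ZMod d) (ZMod d × ZMod d) ℂ) r s,
      twistedCorrelation (weylPhase d) r s (Uᴴ * P * U) (Uᴴ * P * U) =
        (d : ℂ) * ((d : ℂ) * (localWeyl d r * P * (localWeyl d s)ᴴ * Pᴴ).trace) := by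
    intro P r s
    have hs : U * (twistedShift d s)ᴴ = (localWeyl d s)ᴴ * U := by
      have := congrArg conjTranspose (twistedShift_mul_conjTranspose s)
      simpa only [conjTranspose_mul, conjTranspose_conjTranspose] using this
    have : twistedShift d r * (Uᴴ * P * U) * (twistedShift d s)ᴴ * (Uᴴ * P * U)ᴴ =
        Uᴴ * (localWeyl d r * P * (localWeyl d s)ᴴ * (U * Uᴴ) * Pᴴ * U) := by
      have : twistedShift d r * (Uᴴ * P * U) * (twistedShift d s)ᴴ * (Uᴴ * P * U)ᴴ =
          (twistedShift d r * Uᴴ) * P * (U * (twistedShift d s)ᴴ) * Uᴴ * Pᴴ * U := by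
        simp only [conjTranspose_mul, conjTranspose_conjTranspose, Matrix.mul_assoc]
      rw [this, hs, twistedShift_mul_conjTranspose]
      simp only [Matrix.mul_assoc]
      rfl
    rw [twistedCorrelation_eq_trace, this, trace_mul_comm, bellMatrix_mul_conjTranspose,
      Matrix.mul_assoc _ U, bellMatrix_mul_conjTranspose]
    simp only [Matrix.smul_mul, Matrix.mul_smul, Matrix.mul_one, trace_smul, smul_eq_mul]
  have f1 : ∀ χ : PureVec 4 d, (gramData d (bellCoords d χ) (bellCoords d χ)).1 =
      (Uᴴ * pairMatrix (χ : Qudits 4 d) * U) * (Uᴴ * pairMatrix (χ : Qudits 4 d) * U)ᴴ :=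
    fun χ => rfl
  have f2 : ∀ χ : PureVec 4 d, (gramData d (bellCoords d χ) (bellCoords d χ)).2.1 =
      (Uᴴ * pairMatrix (χ : Qudits 4 d) * U)ᴴ * (Uᴴ * pairMatrix (χ : Qudits 4 d) * U) :=
    fun χ => rfl
  have f3 : ∀ χ : PureVec 4 d, (gramData d (bellCoords d χ) (bellCoords d χ)).2.2 = fun r s =>
      twistedCorrelation (weylPhase d) r s (Uᴴ * pairMatrix (χ : Qudits 4 d) * U)
        (Uᴴ * pairMatrix (χ : Qudits 4 d) * U) := fun χ => rfl
  refine Prod.ext ?_ (Prod.ext ?_ ?_)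
  · rw [f1, f1, e1, e1, pairMatrix_mul_conjTranspose_congr hAB]
  · rw [f2, f2, e2, e2, conjTranspose_mul_pairMatrix_congr hCD]
  · rw [f3, f3]
    funext r s
    rw [e3, e3, trace_localWeyl, trace_localWeyl]
    congr 2
    refine Finset.sum_congr rfl fun b _ => Finset.sum_congr rfl fun e _ => ?_
    rw [sum_pairMatrix_congr hBD]

end FourQudits

/-! ### The good point and the conclusion. -/

section Determination

open ComplexConjugate

variable (d : ℕ) [NeZero d]

/-- The polarization of the Gram data in Bell coordinates. -/
noncomputable def gramPolar : Qudits 4 d →ₗ[ℝ] Qudits 4 d →ₗ[ℝ]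
    (ZMod d × ZMod d → ZMod d × ZMod d → ℂ) × (ZMod d × ZMod d → ZMod d × ZMod d → ℂ) ×
      (ZMod d × ZMod d → ZMod d × ZMod d → ℂ) :=
  LinearMap.mk₂ ℝ (fun ψ ξ => gramData d (bellCoords d ψ) (bellCoords d ξ) +
      gramData d (bellCoords d ξ) (bellCoords d ψ))
    (fun x x' y => by
      simp only [map_add, gramData_add_left, gramData_add_right]; abel)
    (fun c x y => by
      simp only [← Complex.coe_smul, map_smul, gramData_smul_left, gramData_smul_right,
        Complex.conj_ofReal, smul_add])
    (fun x y y' => by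
      simp only [map_add, gramData_add_left, gramData_add_right]; abel)
    (fun c x y => by
      simp only [← Complex.coe_smul, map_smul, gramData_smul_left, gramData_smul_right,
        Complex.conj_ofReal, smul_add])

variable {d}

lemma gramPolar_apply (ψ ξ : Qudits 4 d) : gramPolar d ψ ξ =
    gramData d (bellCoords d ψ) (bellCoords d ξ) +
      gramData d (bellCoords d ξ) (bellCoords d ψ) := rfl

lemma gramPolar_symm (ψ ξ : Qudits 4 d) : gramPolar d ψ ξ = gramPolar d ξ ψ := by
  rw [gramPolar_apply, gramPolar_apply, add_comm]

lemma gramPolar_I (ψ ξ : Qudits 4 d) :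
    gramPolar d (Complex.I • ψ) (Complex.I • ξ) = gramPolar d ψ ξ := by
  simp only [gramPolar_apply, map_smul, gramData_smul_left, gramData_smul_right, smul_smul,
    Complex.conj_I, neg_mul, Complex.I_mul_I, neg_neg, one_smul]

lemma exists_injective_weight (G : Type*) [Fintype G] :
    ∃ μ : G → ℝ, Function.Injective μ ∧ (∀ i, 1 ≤ μ i) ∧ ∀ i, μ i ≤ 2 := by
  let e := Fintype.equivFin G
  refine ⟨fun i => 1 + (e i : ℝ) / Fintype.card G, fun i j h => ?_, fun i => ?_, fun i => ?_⟩
  · have : (0 : ℝ) < Fintype.card G := by exact_mod_cast (e i).pos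
    simp only [add_right_inj, div_left_inj' this.ne', Nat.cast_inj] at h
    exact e.injective (Fin.ext h)
  · have : 0 ≤ (e i : ℝ) / Fintype.card G := by positivity
    linarith
  · have : (e i : ℝ) / Fintype.card G ≤ 1 :=
      div_le_one_of_le₀ (by exact_mod_cast (e i).2.le) (by positivity)
    linarith

omit [NeZero d] in
lemma exists_third_element {k : ZMod d × ZMod d} (hk : k ≠ 0) :
    ∃ j : ZMod d × ZMod d, j ≠ 0 ∧ j ≠ k := by
  have hne : (1 : ZMod d) ≠ 0 := by
    intro h
    have : ∀ x : ZMod d, x = 0 := fun x => by rw [← mul_one x, h, mul_zero]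
    exact hk (Prod.ext (this _) (this _))
  by_cases h : ((1, 0) : ZMod d × ZMod d) = k
  · refine ⟨(0, 1), fun h' => hne (congrArg Prod.snd h'), fun h' => hne ?_⟩
    rw [← h] at h'
    exact congrArg Prod.snd h'
  · exact ⟨(1, 0), fun h' => hne (congrArg Prod.fst h'), h⟩

/-- Comparing `D φ` at `η` and at `i η` separates the linear and the conjugate-linear part. -/
lemma gramData_eq_of_range {φ ψ : Qudits 4 d} (h : ∀ η, ∃ ξ, gramPolar d φ η = gramPolar d ψ ξ)
    (η : ZMod d × ZMod d → ZMod d × ZMod d → ℂ) : ∃ ℓ m,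
      gramData d (bellCoords d φ) η = gramData d (bellCoords d ψ) ℓ +
        gramData d m (bellCoords d ψ) := by
  obtain ⟨ξ₁, h₁⟩ := h ((bellCoords d).symm η)
  obtain ⟨ξ₂, h₂⟩ := h ((bellCoords d).symm (Complex.I • η))
  rw [gramPolar_apply, gramPolar_apply, LinearEquiv.apply_symm_apply] at h₁ h₂
  rw [gramData_smul_left, gramData_smul_right, Complex.conj_I] at h₂
  set P := gramData d (bellCoords d φ) η
  set Q := gramData d η (bellCoords d φ)
  -- The values at `η` and `i η` are `P + Q` and `-i P + i Q`, so `P` is half of the first plus `i`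
  -- times the second. The scalar `i` enters the conjugate-linear slot as `-i`.
  refine ⟨(2⁻¹ : ℂ) • (bellCoords d ξ₁ + (-Complex.I) • bellCoords d ξ₂),
    (2⁻¹ : ℂ) • (bellCoords d ξ₁ + Complex.I • bellCoords d ξ₂), ?_⟩
  simp only [gramData_smul_left, gramData_smul_right, gramData_add_left, gramData_add_right,
    map_neg, Complex.conj_I, neg_neg, map_inv₀, Complex.conj_ofNat]
  have hP : P = (2⁻¹ : ℂ) • ((P + Q) + Complex.I • (-Complex.I • P + Complex.I • Q)) := by
    simp only [smul_add, smul_smul]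
    have h3 : (2⁻¹ : ℂ) * (Complex.I * Complex.I) = -2⁻¹ := by
      rw [Complex.I_mul_I]; norm_num
    have h4 : (2⁻¹ : ℂ) * (Complex.I * -Complex.I) = 2⁻¹ := by
      rw [mul_neg, Complex.I_mul_I]; norm_num
    rw [h3, h4]
    module
  rw [hP, h₁, h₂]
  simp only [smul_add]
  abel

/-- There is a vector satisfying both first-order conditions for the marginals on `AB`, `CD` and
`BD`: a superposition of products of Bell states with one dominant term. -/
lemma exists_gramPolar_determined : ∃ ψ : Qudits 4 d, ψ ≠ 0 ∧
    InfinitesimallyDetermined (gramPolar d) ψ ∧ RangeDetermined (gramPolar d) ψ := by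
  obtain ⟨μ, hμ, hμ1, hμ2⟩ := exists_injective_weight (ZMod d × ZMod d)
  -- Large enough for both systems: above `8 * card` for the phases and at least 12 for the ratios.
  set Λ : ℝ := 8 * Fintype.card (ZMod d × ZMod d) + 12 with hΛ
  have hcard : (0 : ℝ) ≤ Fintype.card (ZMod d × ZMod d) := Nat.cast_nonneg _
  have hΛ3 : 3 < Λ := by linarith
  set w := dominantWeight Λ μ
  have hw : ∀ i, w i ≠ 0 := dominantWeight_ne_zero hμ1 hμ2 hΛ3
  have hwinj := norm_sq_dominantWeight_injective hμ1 hμ2 hΛ3 hμ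
  set ψ := (bellCoords d).symm (diagonalTensor w)
  have hψ : bellCoords d ψ = diagonalTensor w := LinearEquiv.apply_symm_apply _ _
  refine ⟨ψ, fun h0 => ?_, fun ξ hξ => ?_, fun φ hφ => ?_⟩
  · rw [h0, map_zero] at hψ
    exact hw 0 (by simpa [diagonalTensor] using (congrFun (congrFun hψ 0) 0).symm)
  · rw [gramPolar_apply, hψ] at hξ
    obtain ⟨t, ht⟩ := diagonalTensor_infinitesimal (χ := weylPhase d) conj_weylPhase_mul hw hwinj
      (fun η h0 h => phase_eq_zero_of_dominantWeight hμ1 hμ2 (by linarith) η h0 h)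
      (bellCoords d ξ)
      (fun i j => by
        have := congrFun (congrFun (congrArg Prod.fst hξ) i) j
        simpa [gramData, diagonalTensor, apply_ite] using this)
      (fun i j => by
        have := congrFun (congrFun (congrArg (fun p => p.2.1) hξ) i) j
        simpa [gramData, diagonalTensor, apply_ite] using this)
      (fun r => congrFun (congrFun (congrArg (fun p => p.2.2) hξ) r) r)
    refine ⟨t, (bellCoords d).injective ?_⟩
    rw [← Complex.coe_smul, map_smul, map_smul, hψ]
    funext i j
    exact ht i j
  · obtain ⟨a, ha⟩ := diagonalTensor_range (χ := weylPhase d) conj_weylPhase_mul hw hwinj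
      (fun y h0 h => ratio_eq_zero_of_dominantWeight hμ1 hμ2 (by linarith)
        (fun k hk => exists_third_element hk) y h0 h)
      (bellCoords d φ) (fun η => by
        obtain ⟨ℓ, m, h⟩ := gramData_eq_of_range hφ η
        rw [hψ] at h
        refine ⟨ℓ, m, fun i j => ?_, fun i j => ?_, fun r s => ?_⟩
        · have := congrFun (congrFun (congrArg Prod.fst h) i) j
          simpa [gramData, diagonalTensor, apply_ite] using this
        · have := congrFun (congrFun (congrArg (fun p => p.2.1) h) i) j
          simpa [gramData, diagonalTensor, apply_ite] using this
        · exact congrFun (congrFun (congrArg (fun p => p.2.2) h) r) s)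
    refine ⟨a, (bellCoords d).injective ?_⟩
    rw [map_smul, hψ]
    funext i j
    exact ha i j

end Determination

/-- The parties `A, B, C, D` are `0, 1, 2, 3`. -/
theorem theorem2 (d : ℕ) (hd : 1 ≤ d) :
    ∀ᵐ ψ : PureVec 4 d ∂(haarPure 4 d),
      DeterminedAmongPure {({0, 1} : Finset (Fin 4)), {2, 3}, {1, 3}} ψ ∧ IsUDP 2 ψ := by
  have : NeZero d := ⟨by omega⟩
  obtain ⟨ψ₀, h0, h1, h2⟩ := exists_gramPolar_determined (d := d)
  have hae := ae_determined_of_polar gramPolar_symm gramPolar_I h0 h1 h2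
  -- The property passes from `r • x` to `x` because `D` is bilinear.
  have hsphere := ae_toSphere_of_ae (volume : Measure (Qudits 4 d)) hae (by
    intro x r hr h φ hφ
    obtain ⟨a, ha⟩ := h (r • φ) (by
      simp only [map_smul, LinearMap.smul_apply, hφ])
    refine ⟨a, smul_right_injective _ hr.ne' ?_⟩
    change r • φ = r • a • x
    rw [ha, smul_comm])
  refine Measure.ae_smul_measure ?_ _
  filter_upwards [hsphere] with ψ hψ
  have key : ∀ φ : PureVec 4 d, marginal {0, 1} (density φ) = marginal {0, 1} (density ψ) →
      marginal {2, 3} (density φ) = marginal {2, 3} (density ψ) →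
      marginal {1, 3} (density φ) = marginal {1, 3} (density ψ) →
      ∃ z : ℂ, ‖z‖ = 1 ∧ (φ : Qudits 4 d) = z • (ψ : Qudits 4 d) := by
    intro φ hAB hCD hBD
    obtain ⟨z, hz⟩ := hψ φ (by
      rw [gramPolar_apply, gramPolar_apply, gramData_bellCoords_congr hAB hCD hBD])
    refine ⟨z, ?_, hz⟩
    have hn := congrArg norm hz
    rw [norm_smul, norm_eq_of_mem_sphere, norm_eq_of_mem_sphere, mul_one] at hn
    exact hn.symm
  exact ⟨fun φ h => key φ (h _ (by simp)) (h _ (by simp)) (h _ (by simp)),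
    fun φ h => key φ (h _ (by simp)) (h _ (by simp)) (h _ (by simp))⟩
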